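/- Let $I$ be a finite set and $\Omega=(\Omega_{ij})_{i,j\in I}$ an integer matrix with $\Omega_{ii}>0$, $\Omega_{ij}\le 0$ and $(\Omega_{ij}+\Omega_{ji})/\Omega_{ii}\in\mathbb Z_{\le 0}$ for $i\ne j$, and $\gcd_i\Omega_{ii}=1$. On $\mathbb Z[I]$ let $\langle\,,\rangle$ be the bilinear form with $\langle i,j\rangle=\Omega_{ij}$, let $\lambda\cdot\mu=\langle\lambda,\mu\rangle+\langle\mu,\lambda\rangle$, and put $\{\lambda,\mu\}=v^{\lambda\cdot\mu}t^{\langle\mu,\lambda\rangle-\langle\lambda,\mu\rangle}$, $v_i=v^{i\cdot i/2}$, $t_i=t^{i\cdot i/2}$, $[n]_{v,t}=\frac{(vt)^n-(vt^{-1})^{-n}}{vt-(vt^{-1})^{-1}}$, $[n]^!_{v,t}=\prod_{k=1}^n[k]_{v,t}$, $x_i^{(n)}=x_i^n/[n]^!_{v_i,t_i}$. Let $U=U_{v,t}$ be the $\mathbb Q(v,t)$-algebra generated by $E_i,F_i,K_i^{\pm1},K_i'^{\pm1}$ $(i\in I)$ subject to: the $K_i,K'_i$ commute with each other and $K_i^{\pm1}K_i^{\mp1}=K_i'^{\pm1}K_i'^{\mp1}=1$;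 $K_iE_jK_i^{-1}=v^{i\cdot j}t^{\langle j,i\rangle-\langle i,j\rangle}E_j$, $K'_iE_jK_i'^{-1}=v^{-i\cdot j}t^{\langle j,i\rangle-\langle i,j\rangle}E_j$, $K'_iF_jK_i'^{-1}=v^{i\cdot j}t^{\langle i,j\rangle-\langle j,i\rangle}F_j$, $K_iF_jK_i^{-1}=v^{-i\cdot j}t^{\langle i,j\rangle-\langle j,i\rangle}F_j$; $E_iF_j-F_jE_i=\delta_{ij}\frac{K_i-K'_i}{v_i-v_i^{-1}}$; and, for $i\neq j$, with the sums over $p+p'=1-2\frac{i\cdot j}{i\cdot i}$, $\sum(-1)^pt_i^{-p(p'-2\frac{\langle i,j\rangle}{i\cdot i}+2\frac{\langle j,i\rangle}{i\cdot i})}E_i^{(p)}E_jE_i^{(p')}=0$ and $\sum(-1)^pt_i^{-p(p'-2\frac{\langle i,j\rangle}{i\cdot i}+2\frac{\langle j,i\rangle}{i\cdot i})}F_i^{(p')}F_jF_i^{(p)}=0$. It has the comultiplication $\Delta(K_i)=K_i\otimes K_i$, $\Delta(K'_i)=K'_i\otimes K'_i$, $\Delta(E_i)=E_i\otimes1+K_i\otimes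 E_i$, $\Delta(F_i)=1\otimes F_i+F_i\otimes K'_i$ and the counit $\varepsilon(K_i)=\varepsilon(K_i')=1$, $\varepsilon(E_i)=\varepsilon(F_i)=0$; $U$ acts on tensor products of modules through $\Delta$. For $\nu\in\mathbb N[I]$ let $U^+_\nu$ (resp. $U^-_{-\nu}$) be the span of the monomials in the $E_i$ (resp. $F_i$) of degree $\nu$, and for $\mu\in\mathbb Z[I]$ let $K_\mu=\prod K_i^{\mu_i}$, $K'_\mu=\prod K_i'^{\mu_i}$. Let $(\,,)_\phi$ be the skew-Hopf pairing between the subalgebras $U_{\ge0}=\langle E_i,K_i^{\pm1}\rangle$ and $U_{\le0}=\langle F_i,K_i'^{\pm1}\rangle$ (so $(1,y)_\phi=\varepsilon(y)$, $(x,1)_\phi=\varepsilon(x)$, $(x,yy')_\phi=(\Delta(x),y\otimes y')_\phi$, $(xx',y)_\phi=(x\otimes x',\Delta^{op}(y))_\phi$) with $(E_i,F_j)_\phi=\delta_{ij}(v_i^{-1}-v_i)^{-1}$ and $(K_\mu x,K'_\nu y)_\phi=\{\mu,\nu\}\{\mu,\beta\}\{\alpha,\nu\}(x,y)_\phi$ for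 $x\in U^+_\alpha$, $y\in U^-_{-\beta}$. Choose for each $\nu\in\mathbb N[I]$ a basis $\mathbf B_\nu$ of $U^-_{-\nu}$, let $\{b^*\}_{b\in\mathbf B_\nu}$ be the basis of $U^+_\nu$ dual to it under $(\,,)_\phi$, and put $\Theta_\nu=\sum_{b\in\mathbf B_\nu}b\otimes b^*$ and $f(\lambda,\mu)=(K_\lambda,K'_\mu)_\phi^{-1}$ for $\lambda,\mu\in\mathbb Z[I]$. A $U$-module $M$ is a weight module if $M=\bigoplus_{\lambda\in\mathbb Z[I]}M_\lambda$, where $M_\lambda=\{m: K_im=v^{i\cdot\lambda}c_{i,\lambda}m,\ K'_im=v^{-i\cdot\lambda}c_{i,\lambda}m\ \ \forall i\in I\}$ and $c_{i,\lambda}=t^{\langle\lambda,i\rangle-\langle i,\lambda\rangle}$. Let $M$, $M'$ be finite-dimensional weight modules of $U$. Let $P:M\otimes M'\to M'\otimes M$ be the flip, let $\tilde f:M'\otimes M\to M'\otimes M$ be the linear map with $\tilde f(m'\otimes m)=f(\lambda,\mu)\,m'\otimes m$ for $m'\in M'_\lambda$, $m\in M_\mu$. Then only finitely many $\Theta_\nu$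 act on $M'\otimes M$ by a non-zero operator, so that $\Theta=\sum_\nu\Theta_\nu$ is a well-defined operator on $M'\otimes M$, and $$\mathcal R_{M,M'}=\Theta\circ\tilde f\circ P:\ M\otimes M'\to M'\otimes M$$ is an isomorphism of $U$-modules. -/

import Mathlib

open scoped TensorProduct

set_option linter.unusedSectionVars false

noncomputable section

namespace TwoParam

/-- The ground field `ℚ(v,t)`. -/
def Qvt : Type := FractionRing (MvPolynomial (Fin 2) ℚ)

instance : Field Qvt := inferInstanceAs (Field (FractionRing (MvPolynomial (Fin 2) ℚ)))

def v : Qvt := algebraMap (MvPolynomial (Fin 2) ℚ) (FractionRing (MvPolynomial (Fin 2) ℚ)) (MvPolynomial.X 0)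

def t : Qvt := algebraMap (MvPolynomial (Fin 2) ℚ) (FractionRing (MvPolynomial (Fin 2) ℚ)) (MvPolynomial.X 1)

theorem v_ne_zero : v ≠ 0 := by
  intro h
  exact MvPolynomial.X_ne_zero (R := ℚ) (0 : Fin 2)
    ((IsFractionRing.injective (MvPolynomial (Fin 2) ℚ)
      (FractionRing (MvPolynomial (Fin 2) ℚ))) (h.trans (map_zero _).symm))

theorem t_ne_zero : t ≠ 0 := by
  intro h
  exact MvPolynomial.X_ne_zero (R := ℚ) (1 : Fin 2)
    ((IsFractionRing.injective (MvPolynomial (Fin 2) ℚ)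
      (FractionRing (MvPolynomial (Fin 2) ℚ))) (h.trans (map_zero _).symm))

theorem v_pow_ne_one {n : ℕ} (hn : n ≠ 0) : v ^ n ≠ 1 := by
  intro h
  have h1 : (MvPolynomial.X 0 : MvPolynomial (Fin 2) ℚ) ^ n = 1 := by
    apply IsFractionRing.injective (MvPolynomial (Fin 2) ℚ)
      (FractionRing (MvPolynomial (Fin 2) ℚ))
    rw [map_pow, map_one]
    exact h
  have h2 := congrArg (MvPolynomial.eval (fun _ => (0 : ℚ))) h1
  simp [hn] at h2

/-- `[n]_{v,t}` at parameters `x`, `y`. -/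
def qint (x y : Qvt) (n : ℕ) : Qvt :=
  ((x * y) ^ n - ((x * y⁻¹) ^ n)⁻¹) / (x * y - (x * y⁻¹)⁻¹)

/-- `[n]^!_{v,t}` at parameters `x`, `y`. -/
def qfact (x y : Qvt) (n : ℕ) : Qvt := ∏ k ∈ Finset.Icc 1 n, qint x y k

section QAd

variable {A : Type*} [Ring A] [Algebra Qvt A]

/-- Iterated twisted commutator `Y ↦ Y X - α_m X Y`; used to show that `Δ` respects the Serre
relations. -/
def qad (α : ℕ → Qvt) (X Y : A) : ℕ → A
  | 0 => Y
  | m + 1 => qad α X Y m * X - α m • (X * qad α X Y m)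

theorem qad_add (α : ℕ → Qvt) (X Y Y' : A) (m : ℕ) :
    qad α X (Y + Y') m = qad α X Y m + qad α X Y' m := by
  induction m with
  | zero => rfl
  | succ m ih => simp only [qad, ih, add_mul, mul_add, smul_add]; abel

open Polynomial in
def qpoly (α : ℕ → Qvt) (n : ℕ) : Polynomial Qvt :=
  ∏ k ∈ Finset.range n, (1 - C (α k) * X)

theorem qpoly_natDegree (α : ℕ → Qvt) (n : ℕ) : (qpoly α n).natDegree ≤ n := by
  induction n with
  | zero => simp [qpoly]
  | succ n ih =>
    rw [qpoly, Finset.prod_range_succ]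
    refine Polynomial.natDegree_mul_le.trans (Nat.add_le_add ih ?_)
    compute_degree

theorem qpoly_coeff_succ (α : ℕ → Qvt) (n p : ℕ) :
    (qpoly α (n + 1)).coeff (p + 1) = (qpoly α n).coeff (p + 1) - α n * (qpoly α n).coeff p := by
  rw [qpoly, Finset.prod_range_succ, ← qpoly, mul_sub, mul_one, Polynomial.coeff_sub,
    mul_comm (Polynomial.C _), ← mul_assoc, Polynomial.coeff_mul_C, Polynomial.coeff_mul_X, mul_comm]

theorem qpoly_coeff_zero (α : ℕ → Qvt) (n : ℕ) : (qpoly α n).coeff 0 = 1 := by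
  induction n with
  | zero => simp [qpoly]
  | succ n ih => 
    rw [qpoly, Finset.prod_range_succ, ← qpoly, Polynomial.mul_coeff_zero, ih]
    simp

theorem qad_eq (α : ℕ → Qvt) (X Y : A) (n : ℕ) :
    qad α X Y n = ∑ p ∈ Finset.range (n + 1), (qpoly α n).coeff p • (X ^ p * Y * X ^ (n - p)) := by
  induction n with
  | zero => simp [qad, qpoly]
  | succ n ih =>
    have hz : (qpoly α n).coeff (n + 1) = 0 :=
      Polynomial.coeff_eq_zero_of_natDegree_lt (Nat.lt_succ_of_le (qpoly_natDegree α n))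
    have h1 : qad α X Y n * X = ∑ p ∈ Finset.range (n + 1 + 1),
        (qpoly α n).coeff p • (X ^ p * Y * X ^ (n + 1 - p)) := by
      rw [Finset.sum_range_succ _ (n + 1), hz, zero_smul, add_zero, ih, Finset.sum_mul]
      refine Finset.sum_congr rfl fun p hp => ?_
      have : n + 1 - p = (n - p) + 1 := by have := Finset.mem_range.1 hp; omega
      rw [this, pow_succ, smul_mul_assoc, ← mul_assoc]
    have h2 : α n • (X * qad α X Y n) = ∑ p ∈ Finset.range (n + 1),
        (α n * (qpoly α n).coeff p) • (X ^ (p + 1) * Y * X ^ (n + 1 - (p + 1))) := by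
      rw [ih, Finset.mul_sum, Finset.smul_sum]
      refine Finset.sum_congr rfl fun p hp => ?_
      rw [Nat.add_sub_add_right, mul_smul_comm, smul_smul, pow_succ', mul_assoc X, mul_assoc X]
    rw [qad, h1, h2, Finset.sum_range_succ' _ (n + 1), Finset.sum_range_succ' _ (n + 1),
      qpoly_coeff_zero, qpoly_coeff_zero, add_sub_right_comm, ← Finset.sum_sub_distrib]
    congr 1
    refine Finset.sum_congr rfl fun p _ => ?_
    rw [← sub_smul, qpoly_coeff_succ]

end QAd

def qbin (q : Qvt) : ℕ → ℕ → Qvt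
  | _, 0 => 1
  | 0, _ + 1 => 0
  | n + 1, p + 1 => (q ^ (p + 1))⁻¹ * qbin q n (p + 1) + q ^ ((n : ℤ) - p) * qbin q n p

theorem qbin_eq_zero (q : Qvt) (n p : ℕ) (h : n < p) : qbin q n p = 0 := by
  induction n generalizing p with
  | zero => obtain ⟨p, rfl⟩ := Nat.exists_eq_succ_of_ne_zero (by omega : p ≠ 0); rfl
  | succ n ih =>
    obtain ⟨p, rfl⟩ := Nat.exists_eq_succ_of_ne_zero (by omega : p ≠ 0)
    simp only [qbin]
    rw [ih _ (by omega), ih _ (by omega)]; simp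

def qnum (q : Qvt) (n : ℕ) : Qvt := q ^ n - (q ^ n)⁻¹

def qnumfact (q : Qvt) (n : ℕ) : Qvt := ∏ k ∈ Finset.range n, qnum q (k + 1)

theorem qbin_fact (q : Qvt) (hq : q ≠ 0) (a b : ℕ) :
    qbin q (a + b) a * (qnumfact q a * qnumfact q b) = qnumfact q (a + b) := by
  induction a generalizing b with
  | zero => simp [qbin, qnumfact]
  | succ a iha =>
    induction b with
    | zero =>
      have h := iha 0
      simp only [qnumfact, Finset.range_zero, Finset.prod_empty, mul_one, add_zero] at h ⊢
      rw [qbin, qbin_eq_zero q a (a + 1) (by omega), Finset.prod_range_succ, ← h]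
      simp only [mul_zero, zero_add, sub_self, zpow_zero, one_mul]
      rw [← mul_assoc, h, h]
    | succ b ihb =>
      have h1 := iha (b + 1)
      have e1 : a + 1 + (b + 1) = (a + b + 1) + 1 := by ring
      have e2 : a + 1 + b = a + b + 1 := by ring
      have e3 : a + (b + 1) = a + b + 1 := by ring
      rw [e2] at ihb
      rw [e3] at h1
      have s : ∀ n, qnumfact q (n + 1) = qnumfact q n * qnum q (n + 1) := fun n =>
        Finset.prod_range_succ _ _
      rw [e1, qbin, s (a + b + 1)]
      have e4 : q ^ (((a + b + 1 : ℕ) : ℤ) - (a : ℕ)) = q ^ (b + 1) := by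
        rw [← zpow_natCast]; congr 1; push_cast; ring
      rw [e4]
      have key : (q ^ (a + 1))⁻¹ * qnum q (b + 1) + q ^ (b + 1) * qnum q (a + 1)
          = qnum q (a + b + 1 + 1) := by
        have : q ^ (a + b + 1 + 1) = q ^ (a + 1) * q ^ (b + 1) := by ring
        rw [qnum, qnum, qnum, this]
        field_simp
        ring
      rw [← key, mul_add (qnumfact q (a + b + 1))]
      nth_rewrite 1 [← ihb]
      rw [← h1, s a, s b]
      ring

theorem qpoly_coeff (q : Qvt) (hq : q ≠ 0) (n p : ℕ) (τ : Qvt) :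
    (qpoly (fun k => τ * q ^ (2 * (k : ℤ) - n + 1)) n).coeff p = (-1) ^ p * τ ^ p * qbin q n p := by
  induction n generalizing p τ with
  | zero => cases p with
    | zero => simp [qpoly, qbin]
    | succ p => simp [qpoly, qbin, Polynomial.coeff_one]
  | succ n ih =>
    cases p with
    | zero => simp [qpoly_coeff_zero, qbin]
    | succ p =>
      have e : qpoly (fun k => τ * q ^ (2 * (k : ℤ) - (n + 1 : ℕ) + 1)) n
          = qpoly (fun k => (τ * q⁻¹) * q ^ (2 * (k : ℤ) - n + 1)) n := by
        congr 1; funext k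
        rw [mul_assoc]; congr 1
        rw [← zpow_neg_one, ← zpow_add₀ hq]; congr 1; push_cast; ring
      rw [qpoly_coeff_succ, e, ih, ih, qbin, pow_succ q, pow_succ τ]
      have e2 : q ^ (2 * (n : ℤ) - (n + 1 : ℕ) + 1) = q ^ p * q ^ ((n : ℤ) - p) := by
        rw [← zpow_natCast q p, ← zpow_add₀ hq]; congr 1; push_cast; ring
      rw [e2, mul_pow, mul_pow, inv_pow, inv_pow, pow_succ q, mul_inv]
      field_simp
      ring


def tri (y : Qvt) (n : ℕ) : Qvt := ∏ k ∈ Finset.range n, y ^ k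

theorem tri_add (y : Qvt) (a b : ℕ) : tri y (a + b) = tri y a * tri y b * y ^ (a * b) := by
  induction b with
  | zero => simp [tri]
  | succ b ih =>
    have s : ∀ n, tri y (n + 1) = tri y n * y ^ n := fun n => Finset.prod_range_succ _ _
    rw [← add_assoc, s, ih, s, pow_add, mul_add, mul_one, pow_add]
    ring

theorem tri_ne_zero (y : Qvt) (hy : y ≠ 0) (n : ℕ) : tri y n ≠ 0 :=
  Finset.prod_ne_zero_iff.2 fun _ _ => pow_ne_zero _ hy

theorem qint_eq (x y : Qvt) (hx : x ≠ 0) (hy : y ≠ 0) (h1 : qnum x 1 ≠ 0) (k : ℕ) :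
    qint x y (k + 1) = y ^ k * qnum x (k + 1) / qnum x 1 := by
  have e : x * y - (x * y⁻¹)⁻¹ = y * qnum x 1 := by
    rw [qnum, pow_one]; field_simp
  have e' : (x * y) ^ (k + 1) - ((x * y⁻¹) ^ (k + 1))⁻¹ = y ^ (k + 1) * qnum x (k + 1) := by
    rw [qnum, mul_pow, mul_pow, inv_pow]; field_simp
  rw [qint, e, e', pow_succ]
  field_simp

theorem qfact_eq (x y : Qvt) (hx : x ≠ 0) (hy : y ≠ 0) (h1 : qnum x 1 ≠ 0) (n : ℕ) :
    qfact x y n = tri y n * qnumfact x n / qnum x 1 ^ n := by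
  induction n with
  | zero => simp [qfact, tri, qnumfact]
  | succ n ih =>
    rw [qfact, Finset.prod_Icc_succ_top (by omega), ← qfact, ih, qint_eq x y hx hy h1,
      show tri y (n + 1) = tri y n * y ^ n from Finset.prod_range_succ _ _,
      show qnumfact x (n + 1) = qnumfact x n * qnum x (n + 1) from Finset.prod_range_succ _ _,
      pow_succ (qnum x 1)]
    field_simp

theorem qnum_ne_zero {d : ℕ} (hd : d ≠ 0) {k : ℕ} (hk : k ≠ 0) : qnum (v ^ d) k ≠ 0 := by
  intro h
  have h0 : (v ^ d) ^ k ≠ 0 := pow_ne_zero _ (pow_ne_zero _ v_ne_zero)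
  rw [qnum, sub_eq_zero] at h
  have h2 : (v ^ d) ^ k * (v ^ d) ^ k = 1 := by
    nth_rewrite 2 [h]; exact mul_inv_cancel₀ h0
  rw [← pow_mul, ← pow_add] at h2
  exact v_pow_ne_one (by positivity) h2

/-- Coefficient comparison: divided-power coefficients against the product expansion. -/
theorem serre_coeff (d : ℕ) (hd : d ≠ 0) (σ : ℤ) (a b : ℕ) :
    (qpoly (fun k => t ^ σ * (v ^ d) ^ (2 * (k : ℤ) - (a + b : ℕ) + 1)) (a + b)).coeff a
      = qfact (v ^ d) (t ^ d) (a + b) * ((-1) ^ a * t ^ (-((a : ℤ) * ((b : ℤ) * d - σ)))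
        * ((qfact (v ^ d) (t ^ d) a)⁻¹ * (qfact (v ^ d) (t ^ d) b)⁻¹)) := by
  have hv : v ^ d ≠ 0 := pow_ne_zero _ v_ne_zero
  have ht : t ^ d ≠ 0 := pow_ne_zero _ t_ne_zero
  have h1 : qnum (v ^ d) 1 ≠ 0 := qnum_ne_zero hd one_ne_zero
  have hf : ∀ n, qnumfact (v ^ d) n ≠ 0 := fun n =>
    Finset.prod_ne_zero_iff.2 fun k _ => qnum_ne_zero hd (by omega)
  have hT := tri_ne_zero _ ht
  rw [qpoly_coeff _ hv, qfact_eq _ _ hv ht h1, qfact_eq _ _ hv ht h1, qfact_eq _ _ hv ht h1,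
    tri_add, ← qbin_fact _ hv a b]
  have e : t ^ (-((a : ℤ) * ((b : ℤ) * d - σ))) = (t ^ σ) ^ a * ((t ^ d) ^ (a * b))⁻¹ := by
    rw [← zpow_natCast, ← zpow_mul, ← zpow_natCast t d, ← zpow_natCast, ← zpow_mul, ← zpow_neg,
      ← zpow_add₀ t_ne_zero]
    congr 1; push_cast; ring
  rw [e]
  have := hf a
  have := hf b
  have := hT a
  have := hT b
  have := pow_ne_zero (a * b) ht
  rw [pow_add (qnum _ _)]
  field_simp

theorem qfact_ne_zero (d : ℕ) (hd : d ≠ 0) (n : ℕ) : qfact (v ^ d) (t ^ d) n ≠ 0 := by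
  have hv : v ^ d ≠ 0 := pow_ne_zero _ v_ne_zero
  have ht : t ^ d ≠ 0 := pow_ne_zero _ t_ne_zero
  have h1 : qnum (v ^ d) 1 ≠ 0 := qnum_ne_zero hd one_ne_zero
  rw [qfact_eq _ _ hv ht h1]
  exact div_ne_zero (mul_ne_zero (tri_ne_zero _ ht n) (Finset.prod_ne_zero_iff.2 fun k _ =>
    qnum_ne_zero hd (by omega))) (pow_ne_zero _ h1)

theorem qpoly_reflect (α : ℕ → Qvt) (n : ℕ) :
    qpoly (fun k => α (n - 1 - k)) n = qpoly α n :=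
  Finset.prod_range_reflect (fun k => 1 - Polynomial.C (α k) * Polynomial.X) n


/-- The integer matrix `Ω`, which determines the Cartan datum `(I, ·)`. -/
structure Datum (I : Type*) [Fintype I] where
  Ω : I → I → ℤ
  diag_pos : ∀ i, 0 < Ω i i
  offdiag_nonpos : ∀ i j, i ≠ j → Ω i j ≤ 0
  integral : ∀ i j, i ≠ j → ∃ a : ℤ, a ≤ 0 ∧ Ω i j + Ω j i = a * Ω i i
  gcd_diag : Finset.univ.gcd (fun i => Ω i i) = 1

variable {I : Type*} [Fintype I] [DecidableEq I]

/-- `⟨λ, μ⟩` on `ℤ[I]`. -/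
def Datum.ang (D : Datum I) (l m : I → ℤ) : ℤ := ∑ i, ∑ j, l i * m j * D.Ω i j

/-- `λ · μ` on `ℤ[I]`. -/
def Datum.dot (D : Datum I) (l m : I → ℤ) : ℤ := D.ang l m + D.ang m l

/-- The basis vector of `ℤ[I]` attached to `i`. -/
def sg (i : I) : I → ℤ := Pi.single i 1

/-- `{λ, μ} = v^{λ·μ} t^{⟨μ,λ⟩-⟨λ,μ⟩}`. -/
def Datum.brace (D : Datum I) (l m : I → ℤ) : Qvt :=
  v ^ D.dot l m * t ^ (D.ang m l - D.ang l m)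

/-- `v_i = v^{i·i/2}`. -/
def Datum.vi (D : Datum I) (i : I) : Qvt := v ^ D.Ω i i

/-- `t_i = t^{i·i/2}`. -/
def Datum.ti (D : Datum I) (i : I) : Qvt := t ^ D.Ω i i

/-- `1 - 2 (i·j)/(i·i)`. -/
def Datum.serreDeg (D : Datum I) (i j : I) : ℕ := (1 - (D.Ω i j + D.Ω j i) / D.Ω i i).toNat

section Serre

variable {A : Type*} [Ring A] [Algebra Qvt A]

/-- Divided power `x^{(p)} = x^p / [p]^!_{v_i,t_i}`. -/
def Datum.divPow (D : Datum I) (i : I) (x : A) (p : ℕ) : A :=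
  (qfact (D.vi i) (D.ti i) p)⁻¹ • x ^ p

/-- `(-1)^p t_i^{-p(p' - 2⟨i,j⟩/(i·i) + 2⟨j,i⟩/(i·i))}`, where `t_i = t^{(i·i)/2}`. -/
def Datum.serreScalar (D : Datum I) (i j : I) (p p' : ℕ) : Qvt :=
  (-1) ^ p * t ^ (-((p : ℤ) * ((p' : ℤ) * D.Ω i i - D.Ω i j + D.Ω j i)))

/-- The left-hand side of the Serre relation for the `E_i`. -/
def Datum.serreE (D : Datum I) (i j : I) (x y : A) : A :=
  ∑ p ∈ Finset.HasAntidiagonal.antidiagonal (D.serreDeg i j),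
    D.serreScalar i j p.1 p.2 • (D.divPow i x p.1 * y * D.divPow i x p.2)

/-- The left-hand side of the Serre relation for the `F_i`. -/
def Datum.serreF (D : Datum I) (i j : I) (x y : A) : A :=
  ∑ p ∈ Finset.HasAntidiagonal.antidiagonal (D.serreDeg i j),
    D.serreScalar i j p.1 p.2 • (D.divPow i x p.2 * y * D.divPow i x p.1)

theorem Datum.exists_nat (D : Datum I) (i : I) : ∃ d : ℕ, d ≠ 0 ∧ D.Ω i i = d := by
  refine ⟨(D.Ω i i).toNat, ?_, ?_⟩ <;> have := D.diag_pos i <;> omega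

theorem Datum.serreDeg_eq (D : Datum I) (i j : I) (h : i ≠ j) :
    D.Ω i j + D.Ω j i = (1 - (D.serreDeg i j : ℤ)) * D.Ω i i := by
  obtain ⟨a, ha, e⟩ := D.integral i j h
  have := D.diag_pos i
  rw [Datum.serreDeg, e, Int.mul_ediv_cancel _ (by omega), Int.toNat_of_nonneg (by omega)]
  ring

/-- The scalars in the factorised form of the Serre element. -/
def Datum.sα (D : Datum I) (i j : I) (k : ℕ) : Qvt :=
  t ^ (D.Ω i j - D.Ω j i) * v ^ (D.Ω i i * (2 * (k : ℤ) - D.serreDeg i j + 1))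

def Datum.sα' (D : Datum I) (i j : I) (k : ℕ) : Qvt :=
  t ^ (D.Ω i j - D.Ω j i) * v ^ (D.Ω i i * (D.serreDeg i j - 1 - 2 * (k : ℤ)))

theorem Datum.qpoly_sα' (D : Datum I) (i j : I) :
    qpoly (D.sα' i j) (D.serreDeg i j) = qpoly (D.sα i j) (D.serreDeg i j) := by
  rw [← qpoly_reflect]
  refine Finset.prod_congr rfl fun k hk => ?_
  have hk := Finset.mem_range.1 hk
  have : D.sα' i j (D.serreDeg i j - 1 - k) = D.sα i j k := by
    rw [Datum.sα', Datum.sα]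
    congr 3
    omega
  exact congrArg (fun c => 1 - Polynomial.C c * Polynomial.X) this

theorem Datum.qpoly_sα_coeff (D : Datum I) (i j : I) (a b : ℕ) (h : a + b = D.serreDeg i j) :
    (qpoly (D.sα i j) (D.serreDeg i j)).coeff a
      = qfact (D.vi i) (D.ti i) (D.serreDeg i j) * (D.serreScalar i j a b *
        ((qfact (D.vi i) (D.ti i) a)⁻¹ * (qfact (D.vi i) (D.ti i) b)⁻¹)) := by
  obtain ⟨d, hd, e⟩ := D.exists_nat i
  have e1 : D.sα i j = fun k : ℕ => t ^ (D.Ω i j - D.Ω j i) *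
      (v ^ d) ^ (2 * (k : ℤ) - (D.serreDeg i j : ℕ) + 1) := by
    funext k
    rw [Datum.sα, e, zpow_mul, zpow_natCast]
  rw [e1, ← h, serre_coeff d hd, Datum.vi, Datum.ti, e, zpow_natCast, zpow_natCast,
    Datum.serreScalar, e]
  congr 4
  ring

theorem Datum.qfact_ne_zero (D : Datum I) (i : I) (n : ℕ) : qfact (D.vi i) (D.ti i) n ≠ 0 := by
  obtain ⟨d, hd, e⟩ := D.exists_nat i
  rw [Datum.vi, Datum.ti, e, zpow_natCast, zpow_natCast]
  exact TwoParam.qfact_ne_zero d hd n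

theorem Datum.qad_sα (D : Datum I) (i j : I) (x y : A) :
    qad (D.sα i j) x y (D.serreDeg i j)
      = qfact (D.vi i) (D.ti i) (D.serreDeg i j) • D.serreE i j x y := by
  rw [qad_eq, Datum.serreE, Finset.Nat.sum_antidiagonal_eq_sum_range_succ_mk, Finset.smul_sum]
  refine Finset.sum_congr rfl fun p hp => ?_
  have hp := Finset.mem_range.1 hp
  rw [D.qpoly_sα_coeff i j p (D.serreDeg i j - p) (by omega)]
  simp only [Datum.divPow, smul_mul_assoc, mul_smul_comm, smul_smul]
  congr 1
  ring

theorem Datum.qad_sα' (D : Datum I) (i j : I) (x y : A) :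
    qad (D.sα' i j) x y (D.serreDeg i j)
      = qfact (D.vi i) (D.ti i) (D.serreDeg i j) • D.serreE i j x y := by
  rw [← D.qad_sα, qad_eq, qad_eq, D.qpoly_sα']

theorem Datum.serreE_map {B : Type*} [Ring B] [Algebra Qvt B] (D : Datum I) (i j : I)
    (g : A →ₐ[Qvt] B) (x y : A) : g (D.serreE i j x y) = D.serreE i j (g x) (g y) := by
  simp [Datum.serreE, Datum.divPow, map_sum]

theorem Datum.serreF_map {B : Type*} [Ring B] [Algebra Qvt B] (D : Datum I) (i j : I)
    (g : A →ₐ[Qvt] B) (x y : A) : g (D.serreF i j x y) = D.serreF i j (g x) (g y) := by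
  simp [Datum.serreF, Datum.divPow, map_sum]

theorem Datum.serreF_op (D : Datum I) (i j : I) (x y : A) :
    MulOpposite.op (D.serreF i j x y)
      = D.serreE i j (MulOpposite.op x) (MulOpposite.op y) := by
  simp only [Datum.serreF, Datum.serreE, Datum.divPow, Finset.op_sum, MulOpposite.op_smul,
    MulOpposite.op_mul, MulOpposite.op_pow, mul_assoc]

end Serre

/-- Generators of `U_{v,t}`. -/
inductive Gen (I : Type*)
  | E (i : I)
  | F (i : I)
  | K (i : I)
  | Kinv (i : I)
  | K' (i : I)
  | K'inv (i : I)

open Gen FreeAlgebra in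
/-- The defining relations of `U_{v,t}`. -/
inductive Rel (D : Datum I) : FreeAlgebra Qvt (Gen I) → FreeAlgebra Qvt (Gen I) → Prop
  | K_Kinv (i : I) : Rel D (ι Qvt (K i) * ι Qvt (Kinv i)) 1
  | Kinv_K (i : I) : Rel D (ι Qvt (Kinv i) * ι Qvt (K i)) 1
  | K'_K'inv (i : I) : Rel D (ι Qvt (K' i) * ι Qvt (K'inv i)) 1
  | K'inv_K' (i : I) : Rel D (ι Qvt (K'inv i) * ι Qvt (K' i)) 1
  | K_comm (i j : I) : Rel D (ι Qvt (K i) * ι Qvt (K j)) (ι Qvt (K j) * ι Qvt (K i))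
  | K_K'_comm (i j : I) : Rel D (ι Qvt (K i) * ι Qvt (K' j)) (ι Qvt (K' j) * ι Qvt (K i))
  | K'_comm (i j : I) : Rel D (ι Qvt (K' i) * ι Qvt (K' j)) (ι Qvt (K' j) * ι Qvt (K' i))
  | K_E (i j : I) : Rel D (ι Qvt (K i) * ι Qvt (E j) * ι Qvt (Kinv i))
      ((v ^ D.dot (sg i) (sg j) * t ^ (D.ang (sg j) (sg i) - D.ang (sg i) (sg j))) • ι Qvt (E j))
  | K'_E (i j : I) : Rel D (ι Qvt (K' i) * ι Qvt (E j) * ι Qvt (K'inv i))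
      ((v ^ (-D.dot (sg i) (sg j)) * t ^ (D.ang (sg j) (sg i) - D.ang (sg i) (sg j))) • ι Qvt (E j))
  | K'_F (i j : I) : Rel D (ι Qvt (K' i) * ι Qvt (F j) * ι Qvt (K'inv i))
      ((v ^ D.dot (sg i) (sg j) * t ^ (D.ang (sg i) (sg j) - D.ang (sg j) (sg i))) • ι Qvt (F j))
  | K_F (i j : I) : Rel D (ι Qvt (K i) * ι Qvt (F j) * ι Qvt (Kinv i))
      ((v ^ (-D.dot (sg i) (sg j)) * t ^ (D.ang (sg i) (sg j) - D.ang (sg j) (sg i))) • ι Qvt (F j))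
  | E_F (i j : I) : Rel D (ι Qvt (E i) * ι Qvt (F j) - ι Qvt (F j) * ι Qvt (E i))
      (if i = j then (D.vi i - (D.vi i)⁻¹)⁻¹ • (ι Qvt (K i) - ι Qvt (K' i)) else 0)
  | serre_E (i j : I) (h : i ≠ j) : Rel D (D.serreE i j (ι Qvt (E i)) (ι Qvt (E j))) 0
  | serre_F (i j : I) (h : i ≠ j) : Rel D (D.serreF i j (ι Qvt (F i)) (ι Qvt (F j))) 0

/-- The two-parameter quantum algebra `U_{v,t}`. -/
def U (D : Datum I) : Type _ := RingQuot (Rel D)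

instance (D : Datum I) : Ring (U D) := inferInstanceAs (Ring (RingQuot (Rel D)))

instance (D : Datum I) : Algebra Qvt (U D) := inferInstanceAs (Algebra Qvt (RingQuot (Rel D)))

/-- The quotient map from the free algebra. -/
def U.mk (D : Datum I) : FreeAlgebra Qvt (Gen I) →ₐ[Qvt] U D := RingQuot.mkAlgHom Qvt (Rel D)

theorem U.mk_rel (D : Datum I) {a b : FreeAlgebra Qvt (Gen I)} (h : Rel D a b) :
    U.mk D a = U.mk D b := RingQuot.mkAlgHom_rel Qvt h

/-- The universal property of `U_{v,t}`. -/
def U.lift (D : Datum I) {A : Type*} [Ring A] [Algebra Qvt A] (g : Gen I → A)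
    (hg : ∀ a b, Rel D a b → FreeAlgebra.lift Qvt g a = FreeAlgebra.lift Qvt g b) :
    U D →ₐ[Qvt] A := RingQuot.liftAlgHom Qvt ⟨FreeAlgebra.lift Qvt g, fun {a b} h => hg a b h⟩

/-- The image of a generator in `U_{v,t}`. -/
def U.gen (D : Datum I) (x : Gen I) : U D := U.mk D (FreeAlgebra.ι Qvt x)

theorem U.lift_gen (D : Datum I) {A : Type*} [Ring A] [Algebra Qvt A] (g : Gen I → A)
    (hg : ∀ a b, Rel D a b → FreeAlgebra.lift Qvt g a = FreeAlgebra.lift Qvt g b) (x : Gen I) :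
    U.lift D g hg (U.gen D x) = g x := by
  have := RingQuot.liftAlgHom_mkAlgHom_apply (S := Qvt) (s := Rel D) (FreeAlgebra.lift Qvt g)
    (fun {a b} h => hg a b h) (FreeAlgebra.ι Qvt x)
  exact this.trans (FreeAlgebra.lift_ι_apply _ _)

def U.E (D : Datum I) (i : I) : U D := U.gen D (.E i)
def U.F (D : Datum I) (i : I) : U D := U.gen D (.F i)
def U.K (D : Datum I) (i : I) : U D := U.gen D (.K i)
def U.Kinv (D : Datum I) (i : I) : U D := U.gen D (.Kinv i)
def U.K' (D : Datum I) (i : I) : U D := U.gen D (.K' i)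
def U.K'inv (D : Datum I) (i : I) : U D := U.gen D (.K'inv i)

section Comul

variable (D : Datum I)

/-- Values of the comultiplication on the generators. -/
def comulGen : Gen I → U D ⊗[Qvt] U D
  | .E i => U.E D i ⊗ₜ 1 + U.K D i ⊗ₜ U.E D i
  | .F i => 1 ⊗ₜ U.F D i + U.F D i ⊗ₜ U.K' D i
  | .K i => U.K D i ⊗ₜ U.K D i
  | .Kinv i => U.Kinv D i ⊗ₜ U.Kinv D i
  | .K' i => U.K' D i ⊗ₜ U.K' D i
  | .K'inv i => U.K'inv D i ⊗ₜ U.K'inv D i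

/-- Values of the counit on the generators. -/
def counitGen : Gen I → Qvt
  | .E _ => 0
  | .F _ => 0
  | _ => 1

theorem ang_sg (i j : I) : D.ang (sg i) (sg j) = D.Ω i j := by
  simp [Datum.ang, sg, Pi.single_apply]

theorem U.K_Kinv (i : I) : U.K D i * U.Kinv D i = 1 := by
  simpa [U.K, U.Kinv, U.gen] using U.mk_rel D (Rel.K_Kinv i)
theorem U.Kinv_K (i : I) : U.Kinv D i * U.K D i = 1 := by
  simpa [U.K, U.Kinv, U.gen] using U.mk_rel D (Rel.Kinv_K i)
theorem U.K'_K'inv (i : I) : U.K' D i * U.K'inv D i = 1 := by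
  simpa [U.K', U.K'inv, U.gen] using U.mk_rel D (Rel.K'_K'inv i)
theorem U.K'inv_K' (i : I) : U.K'inv D i * U.K' D i = 1 := by
  simpa [U.K', U.K'inv, U.gen] using U.mk_rel D (Rel.K'inv_K' i)
theorem U.K_comm (i j : I) : U.K D i * U.K D j = U.K D j * U.K D i := by
  simpa [U.K, U.gen] using U.mk_rel D (Rel.K_comm i j)
theorem U.K_K'_comm (i j : I) : U.K D i * U.K' D j = U.K' D j * U.K D i := by
  simpa [U.K, U.K', U.gen] using U.mk_rel D (Rel.K_K'_comm i j)
theorem U.K'_comm (i j : I) : U.K' D i * U.K' D j = U.K' D j * U.K' D i := by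
  simpa [U.K', U.gen] using U.mk_rel D (Rel.K'_comm i j)

theorem U.K_E (i j : I) : U.K D i * U.E D j =
    (v ^ (D.Ω i j + D.Ω j i) * t ^ (D.Ω j i - D.Ω i j)) • (U.E D j * U.K D i) := by
  have h := U.mk_rel D (Rel.K_E i j)
  simp only [map_mul, map_smul, Datum.dot, ang_sg] at h
  have h' := congrArg (· * U.K D i) h
  simp only [smul_mul_assoc] at h'
  rw [mul_assoc] at h'
  exact (by rw [show U.mk D (FreeAlgebra.ι Qvt (Gen.Kinv i)) = U.Kinv D i from rfl,
    U.Kinv_K, mul_one] at h'; exact h')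

theorem U.K'_E (i j : I) : U.K' D i * U.E D j =
    (v ^ (-(D.Ω i j + D.Ω j i)) * t ^ (D.Ω j i - D.Ω i j)) • (U.E D j * U.K' D i) := by
  have h := U.mk_rel D (Rel.K'_E i j)
  simp only [map_mul, map_smul, Datum.dot, ang_sg] at h
  have h' := congrArg (· * U.K' D i) h
  simp only [smul_mul_assoc] at h'
  rw [mul_assoc] at h'
  exact (by rw [show U.mk D (FreeAlgebra.ι Qvt (Gen.K'inv i)) = U.K'inv D i from rfl,
    U.K'inv_K', mul_one] at h'; exact h')

theorem U.K'_F (i j : I) : U.K' D i * U.F D j =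
    (v ^ (D.Ω i j + D.Ω j i) * t ^ (D.Ω i j - D.Ω j i)) • (U.F D j * U.K' D i) := by
  have h := U.mk_rel D (Rel.K'_F i j)
  simp only [map_mul, map_smul, Datum.dot, ang_sg] at h
  have h' := congrArg (· * U.K' D i) h
  simp only [smul_mul_assoc] at h'
  rw [mul_assoc] at h'
  exact (by rw [show U.mk D (FreeAlgebra.ι Qvt (Gen.K'inv i)) = U.K'inv D i from rfl,
    U.K'inv_K', mul_one] at h'; exact h')

theorem U.K_F (i j : I) : U.K D i * U.F D j =
    (v ^ (-(D.Ω i j + D.Ω j i)) * t ^ (D.Ω i j - D.Ω j i)) • (U.F D j * U.K D i) := by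
  have h := U.mk_rel D (Rel.K_F i j)
  simp only [map_mul, map_smul, Datum.dot, ang_sg] at h
  have h' := congrArg (· * U.K D i) h
  simp only [smul_mul_assoc] at h'
  rw [mul_assoc] at h'
  exact (by rw [show U.mk D (FreeAlgebra.ι Qvt (Gen.Kinv i)) = U.Kinv D i from rfl,
    U.Kinv_K, mul_one] at h'; exact h')

theorem U.E_F (i j : I) : U.E D i * U.F D j - U.F D j * U.E D i =
    if i = j then (D.vi i - (D.vi i)⁻¹)⁻¹ • (U.K D i - U.K' D i) else 0 := by
  have h := U.mk_rel D (Rel.E_F i j)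
  rw [apply_ite (U.mk D)] at h
  simpa [map_sub, map_mul, map_smul, U.E, U.F, U.K, U.K', U.gen] using h

theorem U.serre_E (i j : I) (h : i ≠ j) : D.serreE i j (U.E D i) (U.E D j) = 0 := by
  have := U.mk_rel D (Rel.serre_E i j h)
  rwa [Datum.serreE_map, map_zero] at this

theorem U.serre_F (i j : I) (h : i ≠ j) : D.serreF i j (U.F D i) (U.F D j) = 0 := by
  have := U.mk_rel D (Rel.serre_F i j h)
  rwa [Datum.serreF_map, map_zero] at this

theorem conj_smul {A : Type*} [Ring A] [Algebra Qvt A] {k l e : A} {c : Qvt}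
    (h : k * e = c • (e * k)) (h1 : k * l = 1) : k * e * l = c • e := by
  rw [h, smul_mul_assoc, mul_assoc, h1, mul_one]


section Abstract

variable {A : Type*} [Ring A] [Algebra Qvt A]

theorem qad_conj (α : ℕ → Qvt) {X Y K : A} {a b : Qvt} (hX : K * X = a • (X * K))
    (hY : K * Y = b • (Y * K)) (m : ℕ) :
    K * qad α X Y m = (a ^ m * b) • (qad α X Y m * K) := by
  induction m with
  | zero => simpa [qad] using hY
  | succ m ih =>
    simp only [qad, mul_sub, sub_mul, smul_sub, mul_smul_comm, smul_mul_assoc]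
    rw [← mul_assoc, ih, ← mul_assoc K X, hX]
    simp only [smul_mul_assoc, mul_assoc, hX, ih, mul_smul_comm, smul_smul]
    congr 2
    · ring
    · ring

theorem qad_left (α : ℕ → Qvt) {X Y K : A} {a b : Qvt} (hX : K * X = a • (X * K))
    (hY : K * Y = b • (Y * K)) (hα : ∀ m, α m * (a ^ m * b) = 1) (m : ℕ) :
    qad α (X ⊗ₜ[Qvt] (1 : A) + K ⊗ₜ[Qvt] X) (Y ⊗ₜ[Qvt] (1 : A)) m
      = qad α X Y m ⊗ₜ[Qvt] (1 : A) := by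
  induction m with
  | zero => rfl
  | succ m ih =>
    simp only [qad, ih, mul_add, add_mul, Algebra.TensorProduct.tmul_mul_tmul, one_mul, mul_one,
      qad_conj α hX hY m, smul_add, TensorProduct.sub_tmul, TensorProduct.smul_tmul', smul_smul, hα,
      one_smul]
    abel

theorem qad_right (α : ℕ → Qvt) {X Y K L : A} {a b : Qvt} (hX : K * X = a • (X * K))
    (hL : L * X = b • (X * L)) (hKL : K * L = L * K) (hα : ∀ m, α m = a ^ m * b) (m : ℕ) :
    qad α (X ⊗ₜ[Qvt] (1 : A) + K ⊗ₜ[Qvt] X) (L ⊗ₜ[Qvt] Y) m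
      = (K ^ m * L) ⊗ₜ[Qvt] qad α X Y m := by
  have hc : ∀ m, (K ^ m * L) * X = α m • (X * (K ^ m * L)) := by
    intro m
    induction m with
    | zero => simp [hα, hL]
    | succ m ih =>
      rw [pow_succ', mul_assoc, mul_assoc, ← mul_assoc (K ^ m), ih, mul_smul_comm, ← mul_assoc K X,
        hX, smul_mul_assoc, smul_smul, hα, hα]
      simp only [mul_assoc]
      congr 1; ring
  have hk : ∀ m, (K ^ m * L) * K = K ^ (m + 1) * L := by
    intro m
    rw [mul_assoc, ← hKL, ← mul_assoc, pow_succ]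
  induction m with
  | zero => simp [qad]
  | succ m ih =>
    simp only [qad, ih, mul_add, add_mul, Algebra.TensorProduct.tmul_mul_tmul, one_mul, mul_one,
      hc, hk, smul_add, TensorProduct.tmul_sub, TensorProduct.tmul_smul, TensorProduct.smul_tmul']
    rw [← mul_assoc K, ← pow_succ']
    abel

theorem serreE_comul (D : Datum I) (i j : I) (α β : ℕ → Qvt)
    (hα' : qpoly α (D.serreDeg i j) = qpoly (D.sα i j) (D.serreDeg i j))
    (hβ' : qpoly β (D.serreDeg i j) = qpoly (D.sα i j) (D.serreDeg i j))
    {X Y K L : A} {a b c : Qvt} (hX : K * X = a • (X * K))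
    (hY : K * Y = b • (Y * K)) (hL : L * X = c • (X * L)) (hKL : K * L = L * K)
    (hα : ∀ m, α m * (a ^ m * b) = 1) (hβ : ∀ m, β m = a ^ m * c)
    (h0 : D.serreE i j X Y = 0) :
    D.serreE i j (X ⊗ₜ[Qvt] (1 : A) + K ⊗ₜ[Qvt] X) (Y ⊗ₜ[Qvt] (1 : A) + L ⊗ₜ[Qvt] Y) = 0 := by
  have key : ∀ (γ : ℕ → Qvt), qpoly γ (D.serreDeg i j) = qpoly (D.sα i j) (D.serreDeg i j) →
      qad γ X Y (D.serreDeg i j) = 0 := by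
    intro γ hγ
    have := D.qad_sα i j X Y
    rw [h0, smul_zero, qad_eq, ← hγ, ← qad_eq] at this
    exact this
  have h := D.qad_sα i j (X ⊗ₜ[Qvt] (1 : A) + K ⊗ₜ[Qvt] X) (Y ⊗ₜ[Qvt] (1 : A) + L ⊗ₜ[Qvt] Y)
  rw [qad_add] at h
  have h1 : qad (D.sα i j) (X ⊗ₜ[Qvt] (1 : A) + K ⊗ₜ[Qvt] X) (Y ⊗ₜ[Qvt] (1 : A))
      (D.serreDeg i j) = 0 := by
    rw [qad_eq, ← hα', ← qad_eq, qad_left α hX hY hα, key α hα', TensorProduct.zero_tmul]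
  have h2 : qad (D.sα i j) (X ⊗ₜ[Qvt] (1 : A) + K ⊗ₜ[Qvt] X) (L ⊗ₜ[Qvt] Y)
      (D.serreDeg i j) = 0 := by
    rw [qad_eq, ← hβ', ← qad_eq, qad_right β hX hL hKL hβ, key β hβ', TensorProduct.tmul_zero]
  rw [h1, h2, add_zero] at h
  exact (smul_eq_zero.1 h.symm).resolve_left (D.qfact_ne_zero i _)

end Abstract

theorem comul_serreE (i j : I) (h : i ≠ j) :
    D.serreE i j (comulGen D (.E i)) (comulGen D (.E j)) = 0 := by
  have hd := D.serreDeg_eq i j h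
  refine serreE_comul D i j (D.sα' i j) (D.sα i j) (D.qpoly_sα' i j) rfl (U.K_E D i i)
    (U.K_E D i j) (U.K_E D j i) (U.K_comm D i j) ?_ ?_ (U.serre_E D i j h)
  · intro m
    have hv := v_ne_zero
    have ht := t_ne_zero
    rw [Datum.sα', hd, sub_self, zpow_zero, mul_one, ← zpow_natCast, ← zpow_mul,
      show ∀ x y z w u : Qvt, x * y * (z * (w * u)) = (x * u) * (y * z * w) by intros; ring,
      ← zpow_add₀ ht, ← zpow_add₀ hv, ← zpow_add₀ hv]
    rw [show D.Ω i j - D.Ω j i + (D.Ω j i - D.Ω i j) = 0 by ring, zpow_zero, one_mul]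
    convert zpow_zero v using 2
    ring
  · intro m
    have hv := v_ne_zero
    rw [Datum.sα, add_comm (D.Ω j i), hd, sub_self, zpow_zero, mul_one, ← zpow_natCast, ← zpow_mul,
      ← mul_assoc, ← zpow_add₀ hv, mul_comm]
    congr 2
    ring

theorem op_comm_smul {A : Type*} [Ring A] [Algebra Qvt A] {x k : A} {c : Qvt} (hc : c ≠ 0)
    (h : k * x = c • (x * k)) :
    MulOpposite.op k * MulOpposite.op x = c⁻¹ • (MulOpposite.op x * MulOpposite.op k) := by
  rw [← MulOpposite.op_mul, ← MulOpposite.op_mul, h, MulOpposite.op_smul, smul_smul,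
    inv_mul_cancel₀ hc, one_smul]

theorem vt_ne_zero (a b : ℤ) : v ^ a * t ^ b ≠ 0 :=
  mul_ne_zero (zpow_ne_zero _ v_ne_zero) (zpow_ne_zero _ t_ne_zero)

theorem comul_serreF (i j : I) (h : i ≠ j) :
    D.serreF i j (comulGen D (.F i)) (comulGen D (.F j)) = 0 := by
  have hd := D.serreDeg_eq i j h
  have hv := v_ne_zero
  have ht := t_ne_zero
  have key := serreE_comul D i j (D.sα i j) (D.sα' i j) rfl (D.qpoly_sα' i j)
    (op_comm_smul (vt_ne_zero _ _) (U.K'_F D i i))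
    (op_comm_smul (vt_ne_zero _ _) (U.K'_F D i j)) (op_comm_smul (vt_ne_zero _ _) (U.K'_F D j i))
    (by rw [← MulOpposite.op_mul, ← MulOpposite.op_mul, U.K'_comm D i j]) ?_ ?_
    (by rw [← Datum.serreF_op, U.serre_F D i j h, MulOpposite.op_zero])
  · have k2 := congrArg ((Algebra.TensorProduct.opAlgEquiv Qvt Qvt (U D) (U D)).toAlgHom.comp
      (Algebra.TensorProduct.comm Qvt (U D)ᵐᵒᵖ (U D)ᵐᵒᵖ).toAlgHom) key
    rw [Datum.serreE_map, map_zero] at k2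
    apply MulOpposite.op_injective
    rw [Datum.serreF_op, MulOpposite.op_zero, ← k2]
    congr 1
  · intro m
    rw [Datum.sα, hd, sub_self, zpow_zero, mul_one, inv_pow, ← mul_inv, ← zpow_natCast, ← zpow_mul,
      mul_inv_eq_one₀ (mul_ne_zero (zpow_ne_zero _ hv) (vt_ne_zero _ _)), ← mul_assoc,
      ← zpow_add₀ hv, mul_comm]
    congr 2
    ring
  · intro m
    rw [Datum.sα', add_comm (D.Ω j i), hd, sub_self, zpow_zero, mul_one, inv_pow, ← mul_inv,
      ← zpow_natCast, ← zpow_mul, ← mul_assoc, ← zpow_add₀ hv, mul_inv, ← zpow_neg, ← zpow_neg,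
      mul_comm]
    congr 2 <;> ring

theorem conj_one {A : Type*} [Ring A] {k l e : A} (h : k * e = e * k) (h1 : k * l = 1) :
    k * e * l = e := by
  rw [h, mul_assoc, h1, mul_one]

theorem comul_rel (a b : FreeAlgebra Qvt (Gen I)) (h : Rel D a b) :
    FreeAlgebra.lift Qvt (comulGen D) a = FreeAlgebra.lift Qvt (comulGen D) b := by
  cases h with
  | K_Kinv i => simp [comulGen, U.K_Kinv, Algebra.TensorProduct.one_def]
  | Kinv_K i => simp [comulGen, U.Kinv_K, Algebra.TensorProduct.one_def]
  | K'_K'inv i => simp [comulGen, U.K'_K'inv, Algebra.TensorProduct.one_def]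
  | K'inv_K' i => simp [comulGen, U.K'inv_K', Algebra.TensorProduct.one_def]
  | K_comm i j => simp [comulGen, U.K_comm D i j]
  | K_K'_comm i j => simp [comulGen, U.K_K'_comm D i j]
  | K'_comm i j => simp [comulGen, U.K'_comm D i j]
  | K_E i j =>
    simp only [map_mul, map_smul, FreeAlgebra.lift_ι_apply, comulGen, mul_add, add_mul, smul_add,
      Algebra.TensorProduct.tmul_mul_tmul, mul_one, U.K_Kinv, Datum.dot, ang_sg,
      conj_smul (U.K_E D i j) (U.K_Kinv D i), conj_one (U.K_comm D i j) (U.K_Kinv D i),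
      TensorProduct.tmul_smul, TensorProduct.smul_tmul']
  | K'_E i j =>
    simp only [map_mul, map_smul, FreeAlgebra.lift_ι_apply, comulGen, mul_add, add_mul, smul_add,
      Algebra.TensorProduct.tmul_mul_tmul, mul_one, U.K'_K'inv, Datum.dot, ang_sg,
      conj_smul (U.K'_E D i j) (U.K'_K'inv D i),
      conj_one (U.K_K'_comm D j i).symm (U.K'_K'inv D i),
      TensorProduct.tmul_smul, TensorProduct.smul_tmul']
  | K'_F i j =>
    simp only [map_mul, map_smul, FreeAlgebra.lift_ι_apply, comulGen, mul_add, add_mul, smul_add,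
      Algebra.TensorProduct.tmul_mul_tmul, mul_one, U.K'_K'inv, Datum.dot, ang_sg,
      conj_smul (U.K'_F D i j) (U.K'_K'inv D i),
      conj_one (U.K'_comm D i j) (U.K'_K'inv D i),
      TensorProduct.tmul_smul, TensorProduct.smul_tmul']
  | K_F i j =>
    simp only [map_mul, map_smul, FreeAlgebra.lift_ι_apply, comulGen, mul_add, add_mul, smul_add,
      Algebra.TensorProduct.tmul_mul_tmul, mul_one, U.K_Kinv, Datum.dot, ang_sg,
      conj_smul (U.K_F D i j) (U.K_Kinv D i), conj_one (U.K_K'_comm D i j) (U.K_Kinv D i),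
      TensorProduct.tmul_smul, TensorProduct.smul_tmul']
  | E_F i j =>
    have hx : (U.K D i * U.F D j) ⊗ₜ[Qvt] (U.E D i * U.K' D j)
        = (U.F D j * U.K D i) ⊗ₜ[Qvt] (U.K' D j * U.E D i) := by
      rw [U.K_F, U.K'_E, TensorProduct.smul_tmul, add_comm (D.Ω j i)]
    have hl : FreeAlgebra.lift Qvt (comulGen D) (FreeAlgebra.ι Qvt (Gen.E i) *
          FreeAlgebra.ι Qvt (Gen.F j) - FreeAlgebra.ι Qvt (Gen.F j) * FreeAlgebra.ι Qvt (Gen.E i))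
        = (U.E D i * U.F D j - U.F D j * U.E D i) ⊗ₜ U.K' D j
          + U.K D i ⊗ₜ (U.E D i * U.F D j - U.F D j * U.E D i) := by
      simp only [map_mul, map_sub, FreeAlgebra.lift_ι_apply, comulGen, mul_add, add_mul,
        Algebra.TensorProduct.tmul_mul_tmul, mul_one, one_mul, hx, TensorProduct.sub_tmul,
        TensorProduct.tmul_sub]
      abel
    rw [hl, U.E_F]
    split_ifs with hij
    · subst hij
      simp only [map_smul, map_sub, FreeAlgebra.lift_ι_apply, comulGen, TensorProduct.tmul_smul,
        ← TensorProduct.smul_tmul', TensorProduct.sub_tmul, TensorProduct.tmul_sub, ← smul_add]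
      congr 1
      abel
    · simp
  | serre_E i j h =>
    rw [Datum.serreE_map, map_zero]
    simpa using comul_serreE D i j h
  | serre_F i j h =>
    rw [Datum.serreF_map, map_zero]
    simpa using comul_serreF D i j h

/-- The comultiplication `Δ : U → U ⊗ U`. -/
def comul : U D →ₐ[Qvt] U D ⊗[Qvt] U D := U.lift D (comulGen D) (comul_rel D)

theorem counit_rel (a b : FreeAlgebra Qvt (Gen I)) (h : Rel D a b) :
    FreeAlgebra.lift Qvt counitGen a = FreeAlgebra.lift Qvt counitGen b := by
  cases h with
  | E_F i j => split_ifs <;> simp [counitGen]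
  | serre_E i j h => simp [counitGen, Datum.serreE]
  | serre_F i j h => simp [counitGen, Datum.serreF]
  | _ => simp [counitGen]

/-- The counit `ε : U → ℚ(v,t)`. -/
def counit : U D →ₐ[Qvt] Qvt := U.lift D counitGen (counit_rel D)

end Comul

section Pairing

variable (D : Datum I)

/-- `K_i` as a unit. -/
def Kunit (i : I) : (U D)ˣ := ⟨U.K D i, U.Kinv D i, U.K_Kinv D i, U.Kinv_K D i⟩

/-- `K'_i` as a unit. -/
def K'unit (i : I) : (U D)ˣ := ⟨U.K' D i, U.K'inv D i, U.K'_K'inv D i, U.K'inv_K' D i⟩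

theorem Kunit_comm (m : I → ℤ) (s : Set I) :
    s.Pairwise (Function.onFun Commute fun i => ((Kunit D i ^ m i : (U D)ˣ) : U D)) := by
  intro i _ j _ _
  have h : Commute (Kunit D i) (Kunit D j) := Units.ext (U.K_comm D i j)
  exact congrArg Units.val ((h.zpow_zpow (m i) (m j)).eq)

theorem K'unit_comm (m : I → ℤ) (s : Set I) :
    s.Pairwise (Function.onFun Commute fun i => ((K'unit D i ^ m i : (U D)ˣ) : U D)) := by
  intro i _ j _ _
  have h : Commute (K'unit D i) (K'unit D j) := Units.ext (U.K'_comm D i j)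
  exact congrArg Units.val ((h.zpow_zpow (m i) (m j)).eq)

/-- `K_μ = ∏ K_i^{μ_i}` for `μ ∈ ℤ[I]`. -/
def Kw (m : I → ℤ) : U D :=
  Finset.univ.noncommProd (fun i => ((Kunit D i ^ m i : (U D)ˣ) : U D)) (Kunit_comm D m _)

/-- `K'_μ = ∏ K'_i^{μ_i}` for `μ ∈ ℤ[I]`. -/
def K'w (m : I → ℤ) : U D :=
  Finset.univ.noncommProd (fun i => ((K'unit D i ^ m i : (U D)ˣ) : U D)) (K'unit_comm D m _)

/-- The subalgebra `U_{≥0}`, generated by the `E_i` and `K_i^{±1}`. -/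
def Ugeq : Subalgebra Qvt (U D) :=
  Algebra.adjoin Qvt (Set.range (U.E D) ∪ Set.range (U.K D) ∪ Set.range (U.Kinv D))

/-- The subalgebra `U_{≤0}`, generated by the `F_i` and `K'_i^{±1}`. -/
def Uleq : Subalgebra Qvt (U D) :=
  Algebra.adjoin Qvt (Set.range (U.F D) ∪ Set.range (U.K' D) ∪ Set.range (U.K'inv D))

/-- The degree in `ℕ[I]` of the word `i_1 ⋯ i_l`. -/
def wordDeg (w : List I) : I → ℕ := fun i => w.count i

/-- `U^+_ν`: the span of the monomials `E_{i_1} ⋯ E_{i_l}` of degree `ν`. -/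
def Uplus (n : I → ℕ) : Submodule Qvt (U D) :=
  Submodule.span Qvt {x | ∃ w : List I, wordDeg w = n ∧ x = (w.map (U.E D)).prod}

/-- `U^-_{-ν}`: the span of the monomials `F_{i_1} ⋯ F_{i_l}` of degree `ν`. -/
def Uminus (n : I → ℕ) : Submodule Qvt (U D) :=
  Submodule.span Qvt {x | ∃ w : List I, wordDeg w = n ∧ x = (w.map (U.F D)).prod}

theorem E_mem (i : I) : U.E D i ∈ Ugeq D :=
  Algebra.subset_adjoin (Or.inl (Or.inl ⟨i, rfl⟩))

theorem F_mem (i : I) : U.F D i ∈ Uleq D :=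
  Algebra.subset_adjoin (Or.inl (Or.inl ⟨i, rfl⟩))

theorem Kw_mem (m : I → ℤ) : Kw D m ∈ Ugeq D := by
  refine Submonoid.noncommProd_mem (Ugeq D).toSubmonoid _ _ _ fun i _ => ?_
  cases m i with
  | ofNat n =>
    simpa [Kunit] using pow_mem (show U.K D i ∈ Ugeq D from
      Algebra.subset_adjoin (Or.inl (Or.inr ⟨i, rfl⟩))) n
  | negSucc n =>
    rw [zpow_negSucc, ← inv_pow, Units.val_pow_eq_pow_val]
    exact pow_mem (show U.Kinv D i ∈ Ugeq D from
      Algebra.subset_adjoin (Or.inr ⟨i, rfl⟩)) (n + 1)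

theorem K'w_mem (m : I → ℤ) : K'w D m ∈ Uleq D := by
  refine Submonoid.noncommProd_mem (Uleq D).toSubmonoid _ _ _ fun i _ => ?_
  cases m i with
  | ofNat n =>
    simpa [K'unit] using pow_mem (show U.K' D i ∈ Uleq D from
      Algebra.subset_adjoin (Or.inl (Or.inr ⟨i, rfl⟩))) n
  | negSucc n =>
    rw [zpow_negSucc, ← inv_pow, Units.val_pow_eq_pow_val]
    exact pow_mem (show U.K'inv D i ∈ Uleq D from
      Algebra.subset_adjoin (Or.inr ⟨i, rfl⟩)) (n + 1)

theorem Uplus_le (n : I → ℕ) : Uplus D n ≤ Subalgebra.toSubmodule (Ugeq D) := by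
  refine Submodule.span_le.2 ?_
  rintro _ ⟨w, -, rfl⟩
  exact Subalgebra.list_prod_mem _ fun x hx => by
    obtain ⟨i, -, rfl⟩ := List.mem_map.1 hx
    exact E_mem D i

theorem Uminus_le (n : I → ℕ) : Uminus D n ≤ Subalgebra.toSubmodule (Uleq D) := by
  refine Submodule.span_le.2 ?_
  rintro _ ⟨w, -, rfl⟩
  exact Subalgebra.list_prod_mem _ fun x hx => by
    obtain ⟨i, -, rfl⟩ := List.mem_map.1 hx
    exact F_mem D i

/-- `K_μ` as an element of `U_{≥0}`. -/
def Kgeq (m : I → ℤ) : Ugeq D := ⟨Kw D m, Kw_mem D m⟩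

/-- `K'_μ` as an element of `U_{≤0}`. -/
def K'leq (m : I → ℤ) : Uleq D := ⟨K'w D m, K'w_mem D m⟩

/-- The inclusion `ℕ[I] ⊂ ℤ[I]`. -/
def toZ (n : I → ℕ) : I → ℤ := fun i => n i

/-- `φ` is a skew-Hopf pairing `U_{≥0} × U_{≤0} → ℚ(v,t)` with the prescribed values:
`(x, y y') = (Δ(x), y ⊗ y')` and `(x x', y) = (x ⊗ x', Δ^{op}(y))`, where `z` denotes `Δ(x)`
(resp. `Δ(y)`) seen in `U_{≥0} ⊗ U_{≥0}` (resp. `U_{≤0} ⊗ U_{≤0}`). Compatibility with the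
antipodes is a formal consequence of these axioms. -/
structure IsSkewHopfPairing (φ : Ugeq D →ₗ[Qvt] Uleq D →ₗ[Qvt] Qvt) : Prop where
  one_left : ∀ y : Uleq D, φ 1 y = counit D y
  one_right : ∀ x : Ugeq D, φ x 1 = counit D x
  mul_right : ∀ (x : Ugeq D) (y y' : Uleq D) (z : Ugeq D ⊗[Qvt] Ugeq D),
    TensorProduct.map (Ugeq D).val.toLinearMap (Ugeq D).val.toLinearMap z = comul D x →
    φ x (y * y') = LinearMap.mul' Qvt Qvt (TensorProduct.map (φ.flip y) (φ.flip y') z)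
  mul_left : ∀ (x x' : Ugeq D) (y : Uleq D) (z : Uleq D ⊗[Qvt] Uleq D),
    TensorProduct.map (Uleq D).val.toLinearMap (Uleq D).val.toLinearMap z = comul D y →
    φ (x * x') y = LinearMap.mul' Qvt Qvt
      (TensorProduct.map (φ x) (φ x') (TensorProduct.comm Qvt (Uleq D) (Uleq D) z))
  E_F : ∀ i j : I, φ ⟨U.E D i, E_mem D i⟩ ⟨U.F D j, F_mem D j⟩
    = if i = j then ((D.vi i)⁻¹ - D.vi i)⁻¹ else 0
  K_K' : ∀ (m n : I → ℤ) (a b : I → ℕ) (x : Ugeq D) (y : Uleq D),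
    (x : U D) ∈ Uplus D a → (y : U D) ∈ Uminus D b →
    φ (Kgeq D m * x) (K'leq D n * y)
      = D.brace m n * D.brace m (toZ b) * D.brace (toZ a) n * φ x y

open Classical in
/-- The skew-Hopf pairing `(,)_φ` (it exists and is unique). -/
def pairing : Ugeq D →ₗ[Qvt] Uleq D →ₗ[Qvt] Qvt :=
  if h : ∃ φ, IsSkewHopfPairing D φ then h.choose else 0

/-- `f(λ, μ) = (K_λ, K'_μ)_φ^{-1}`. -/
def fmap (l m : I → ℤ) : Qvt := (pairing D (Kgeq D l) (K'leq D m))⁻¹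

open Classical in
/-- A homogeneous basis `B = ⨆ B_ν` of `U^-`, with `B_ν` a basis of `U^-_{-ν}`, together with the
basis `{b^*}` of `U^+_ν` dual to `B_ν` under `(,)_φ`. -/
structure DualBases where
  ix : (I → ℕ) → Type
  fin : ∀ n, Fintype (ix n)
  b : ∀ n, Module.Basis (ix n) Qvt (Uminus D n)
  bs : ∀ n, Module.Basis (ix n) Qvt (Uplus D n)
  dual : ∀ n k l, pairing D ⟨bs n k, Uplus_le D n (bs n k).2⟩ ⟨b n l, Uminus_le D n (b n l).2⟩
    = if k = l then 1 else 0

/-- `Θ_ν = ∑_{b ∈ B_ν} b ⊗ b^*`. -/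
def DualBases.theta {D : Datum I} (B : DualBases D) (n : I → ℕ) : U D ⊗[Qvt] U D :=
  letI := B.fin n
  ∑ k, (B.b n k : U D) ⊗ₜ[Qvt] (B.bs n k : U D)

end Pairing

section Modules

variable (D : Datum I) (M N : Type*) [AddCommGroup M] [Module Qvt M] [Module (U D) M]
  [IsScalarTower Qvt (U D) M] [AddCommGroup N] [Module Qvt N] [Module (U D) N]
  [IsScalarTower Qvt (U D) N]

/-- `c_{i,λ} = t^{⟨λ,i⟩-⟨i,λ⟩}`. -/
def Datum.c (i : I) (l : I → ℤ) : Qvt := t ^ (D.ang l (sg i) - D.ang (sg i) l)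

/-- The weight space `M_λ`, `λ ∈ ℤ[I]`. -/
def weightSpace (l : I → ℤ) : Submodule Qvt M where
  carrier := {x | ∀ i, U.K D i • x = (v ^ D.dot (sg i) l * D.c i l) • x ∧
    U.K' D i • x = (v ^ (-D.dot (sg i) l) * D.c i l) • x}
  add_mem' hx hy i := ⟨by rw [smul_add, smul_add, (hx i).1, (hy i).1],
    by rw [smul_add, smul_add, (hx i).2, (hy i).2]⟩
  zero_mem' i := by simp
  smul_mem' a x hx i := ⟨by rw [← algebraMap_smul (U D) a x, ← mul_smul, ← Algebra.commutes, mul_smul,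
      (hx i).1, algebraMap_smul, algebraMap_smul, smul_comm],
    by rw [← algebraMap_smul (U D) a x, ← mul_smul, ← Algebra.commutes, mul_smul,
      (hx i).2, algebraMap_smul, algebraMap_smul, smul_comm]⟩

/-- `M` is a weight module: `M = ⨁_λ M_λ`. -/
def IsWeightModule : Prop := DirectSum.IsInternal (weightSpace D M)

/-- The action of `U ⊗ U` on `M ⊗ N`. -/
def tensorEnd : U D ⊗[Qvt] U D →ₐ[Qvt] Module.End Qvt (M ⊗[Qvt] N) :=
  (Module.endTensorEndAlgHom (R := Qvt) (S := Qvt) (A := Qvt) (M := M) (N := N)).comp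
    (Algebra.TensorProduct.map (Algebra.lsmul Qvt Qvt M) (Algebra.lsmul Qvt Qvt N))

/-- The `U`-module structure of `M ⊗ N`, through the comultiplication. -/
def tensorAct : U D →ₐ[Qvt] Module.End Qvt (M ⊗[Qvt] N) := (tensorEnd D M N).comp (comul D)

variable {D M N}

/-- The weight decomposition of a weight module. -/
def IsWeightModule.decomp (h : IsWeightModule D M) :
    M ≃ₗ[Qvt] DirectSum (I → ℤ) fun l => weightSpace D M l :=
  (LinearEquiv.ofBijective (DirectSum.coeLinearMap (weightSpace D M)) h).symm

/-- The bilinear map `(m, n) ↦ f(λ, μ) m ⊗ n` for `m ∈ M_λ`, `n ∈ N_μ`. -/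
def ftildeAux (hM : IsWeightModule D M) (hN : IsWeightModule D N) :
    M →ₗ[Qvt] N →ₗ[Qvt] M ⊗[Qvt] N :=
  (DirectSum.toModule Qvt (I → ℤ) (N →ₗ[Qvt] M ⊗[Qvt] N) fun l =>
    ((DirectSum.toModule Qvt (I → ℤ) (weightSpace D M l →ₗ[Qvt] M ⊗[Qvt] N) fun m =>
      fmap D l m • ((TensorProduct.mk Qvt M N).compl₁₂ (weightSpace D M l).subtype
        (weightSpace D N m).subtype).flip).comp hN.decomp.toLinearMap).flip).comp
    hM.decomp.toLinearMap

/-- `f̃ : M ⊗ N → M ⊗ N`. -/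
def ftilde (hM : IsWeightModule D M) (hN : IsWeightModule D N) :
    M ⊗[Qvt] N →ₗ[Qvt] M ⊗[Qvt] N := TensorProduct.lift (ftildeAux hM hN)

variable (M N)

/-- The operator `Θ = ∑_ν Θ_ν` on `M ⊗ N`. -/
def DualBases.thetaOp (B : DualBases D) : Module.End Qvt (M ⊗[Qvt] N) :=
  ∑ᶠ n : I → ℕ, tensorEnd D M N (B.theta n)

variable {M N}

/-- `𝓡 = Θ ∘ f̃ ∘ P : M ⊗ N → N ⊗ M`. -/
def DualBases.Rmat (B : DualBases D) (hM : IsWeightModule D M)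
    (hN : IsWeightModule D N) : M ⊗[Qvt] N →ₗ[Qvt] N ⊗[Qvt] M :=
  B.thetaOp N M ∘ₗ ftilde hN hM ∘ₗ (TensorProduct.comm Qvt M N).toLinearMap

end Modules

end TwoParam

end

/-! The flip exchanges the action of `U` through `Δ` with the action through `Δ^op`. So the content
is that `Θ ∘ f̃` is invertible and carries the `Δ^op`-action to the `Δ`-action; it suffices to check
this on generators of `U`.

The scalars by which `K_i`, `K'_i` commute with `E_j`, `F_j`, and their eigenvalues on weight
spaces, are all values of one bicharacter `{ , }`, and `f(λ, μ) = {λ, μ}⁻¹`. Hence moving `f̃` past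
`Δ^op(E_i) = 1 ⊗ E_i + E_i ⊗ K_i` yields `K'_i ⊗ E_i + E_i ⊗ 1`, and past `Δ^op(F_i)` it yields `F_i
⊗ K_i + 1 ⊗ F_i`. What remains is that `Θ` takes these two elements to `Δ(E_i)` and `Δ(F_i)`, which
is proved degree by degree in `thetaZ_mul_E` and `thetaZ_mul_F`.

The mechanism is `exists_E_comm`. With `c_i = (E_i, F_i)_φ`, every homogeneous `y` in `U^-` admits
`p`, `q` of degree lower by `i` such that `E_i y - y E_i = c_i (K'_i p - K_i q)`, while `(E_i x, y)
= c_i (x, q)` and `(x E_i, y) = c_i (x, K'_i p)` for all `x`. Thus commutators with `E_i` are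
expressed by the adjoints of left and right multiplication by `E_i`. Since `Θ_ν` is the canonical
element of the pairing, an adjoint can be moved from one leg to the other (`sum_tmul_adjoint`), and
`E_i ⊗ 1` commutes with `Θ_ν` up to terms containing `Θ_{ν-i}`. The statement for `F_i` is the
mirror image (`exists_comm_F`). On monomials all these formulas obey the same recursion; `p` and `q`
are only asserted to exist, so the skew derivations defining them on words need not be shown
compatible with the Serre relations.

Invertibility: `Θ_0 = 1`, and every other `Θ_ν` strictly lowers weights in the first factor, so `Θ`
is unipotent (`isUnit_thetaOp`); `f̃` is diagonal with nonzero entries. -/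

noncomputable section

namespace TwoParam

/-! ### The bicharacter `{ , }` and the commutation relations written with it. -/

section Form

variable {I : Type*} [Fintype I] (D : Datum I)

theorem Datum.ang_add_left (a b c : I → ℤ) : D.ang (a + b) c = D.ang a c + D.ang b c := by
  simp only [Datum.ang, Pi.add_apply, add_mul, Finset.sum_add_distrib]

theorem Datum.ang_add_right (a b c : I → ℤ) : D.ang a (b + c) = D.ang a b + D.ang a c := by
  simp only [Datum.ang, Pi.add_apply, mul_add, add_mul, Finset.sum_add_distrib]

theorem Datum.ang_zero_left (a : I → ℤ) : D.ang 0 a = 0 := by simp [Datum.ang]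

theorem Datum.ang_zero_right (a : I → ℤ) : D.ang a 0 = 0 := by simp [Datum.ang]

theorem Datum.brace_ne_zero (a b : I → ℤ) : D.brace a b ≠ 0 := vt_ne_zero _ _

theorem Datum.brace_zero_left (a : I → ℤ) : D.brace 0 a = 1 := by
  simp [Datum.brace, Datum.dot, D.ang_zero_left, D.ang_zero_right]

theorem Datum.brace_zero_right (a : I → ℤ) : D.brace a 0 = 1 := by
  simp [Datum.brace, Datum.dot, D.ang_zero_left, D.ang_zero_right]

theorem Datum.brace_add_left (a b c : I → ℤ) :
    D.brace (a + b) c = D.brace a c * D.brace b c := by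
  simp only [Datum.brace, Datum.dot, D.ang_add_left, D.ang_add_right]
  rw [mul_mul_mul_comm, ← zpow_add₀ v_ne_zero, ← zpow_add₀ t_ne_zero]
  congr 2 <;> ring

theorem Datum.brace_add_right (a b c : I → ℤ) :
    D.brace a (b + c) = D.brace a b * D.brace a c := by
  simp only [Datum.brace, Datum.dot, D.ang_add_left, D.ang_add_right]
  rw [mul_mul_mul_comm, ← zpow_add₀ v_ne_zero, ← zpow_add₀ t_ne_zero]
  congr 2 <;> ring

theorem Datum.brace_inv (a b : I → ℤ) :
    (D.brace a b)⁻¹ = v ^ (-D.dot a b) * t ^ (D.ang a b - D.ang b a) := by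
  rw [Datum.brace, mul_inv, ← zpow_neg, ← zpow_neg]
  congr 2; ring

variable [DecidableEq I]

/-- `(E_i, F_i)_φ = (v_i⁻¹ - v_i)⁻¹`. -/
def Datum.pairEF (i : I) : Qvt := ((D.vi i)⁻¹ - D.vi i)⁻¹

/-- In all four rules `K_i` sees degree `μ` through `{i, μ}` and `K'_i` sees it through `{μ, i}⁻¹`,
with `F_j` counted in degree `-j`. The order of the arguments matters, since `{ , }` need not be
symmetric. -/
theorem U.K_E_brace (i j : I) :
    U.K D i * U.E D j = D.brace (sg i) (sg j) • (U.E D j * U.K D i) := by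
  rw [U.K_E, Datum.brace, Datum.dot, ang_sg, ang_sg]

theorem U.K'_F_brace (i j : I) :
    U.K' D i * U.F D j = D.brace (sg j) (sg i) • (U.F D j * U.K' D i) := by
  rw [U.K'_F, Datum.brace, Datum.dot, ang_sg, ang_sg, add_comm]

theorem U.K_F_brace (i j : I) :
    U.K D i * U.F D j = (D.brace (sg i) (sg j))⁻¹ • (U.F D j * U.K D i) := by
  rw [U.K_F, Datum.brace_inv, Datum.dot, ang_sg, ang_sg]

theorem U.K'_E_brace (i j : I) :
    U.K' D i * U.E D j = (D.brace (sg j) (sg i))⁻¹ • (U.E D j * U.K' D i) := by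
  rw [U.K'_E, Datum.brace_inv, Datum.dot, ang_sg, ang_sg, add_comm]

/-- The sign is absorbed into `K'_i - K_i` so that the scalar becomes the pairing `(E_i, F_i)_φ`;
this is what lets commutators be compared with adjoints. -/
theorem U.E_F_pairEF (i j : I) : U.E D i * U.F D j - U.F D j * U.E D i =
    if i = j then D.pairEF i • (U.K' D i - U.K D i) else 0 := by
  rw [U.E_F]
  congr 1
  rw [Datum.pairEF, ← neg_sub (D.vi i), inv_neg, neg_smul, ← smul_neg, neg_sub]

end Form

/-! ### Spans of words, graded by `ℤ[I]`, and skew derivations on words. -/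

section Words

variable {I : Type*} [DecidableEq I] {A : Type*} [Ring A] [Algebra Qvt A]

theorem toZ_wordDeg_nil : toZ (wordDeg ([] : List I)) = 0 := by
  funext k; simp [toZ, wordDeg]

theorem toZ_wordDeg_cons (j : I) (w : List I) :
    toZ (wordDeg (j :: w)) = sg j + toZ (wordDeg w) := by
  funext k
  by_cases h : j = k
  · subst h; simp [toZ, wordDeg, sg, add_comm]
  · simp [toZ, wordDeg, sg, h, Ne.symm h]

/-- The span of the monomials `g i₁ ⋯ g iₗ` of degree `d ∈ ℤ[I]`. -/
def wordSpan (g : I → A) (d : I → ℤ) : Submodule Qvt A :=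
  Submodule.span Qvt {x | ∃ w : List I, toZ (wordDeg w) = d ∧ x = (w.map g).prod}

theorem word_mem_wordSpan (g : I → A) (w : List I) :
    (w.map g).prod ∈ wordSpan g (toZ (wordDeg w)) :=
  Submodule.subset_span ⟨w, rfl, rfl⟩

theorem mul_mem_wordSpan (g : I → A) (j : I) {d : I → ℤ} {x : A} (hx : x ∈ wordSpan g d) :
    g j * x ∈ wordSpan g (sg j + d) := by
  induction hx using Submodule.span_induction with
  | mem x h =>
    obtain ⟨w, rfl, rfl⟩ := h
    exact Submodule.subset_span ⟨j :: w, toZ_wordDeg_cons j w, by simp⟩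
  | zero => simp
  | add x y _ _ hx hy => rw [mul_add]; exact add_mem hx hy
  | smul a x _ hx => rw [mul_smul_comm]; exact Submodule.smul_mem _ a hx

theorem mul_mem_wordSpan_right (g : I → A) (j : I) {d : I → ℤ} {x : A} (hx : x ∈ wordSpan g d) :
    x * g j ∈ wordSpan g (sg j + d) := by
  induction hx using Submodule.span_induction with
  | mem x h =>
    obtain ⟨w, rfl, rfl⟩ := h
    refine Submodule.subset_span ⟨w ++ [j], ?_, by simp⟩
    rw [← toZ_wordDeg_cons]
    funext k
    simp [toZ, wordDeg, List.count_append, List.count_cons]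
  | zero => simp
  | add x y _ _ hx hy => rw [add_mul]; exact add_mem hx hy
  | smul a x _ hx => rw [smul_mul_assoc]; exact Submodule.smul_mem _ a hx

/-- Grading by `ℤ[I]` makes `d - i` meaningful for every `d`; the price is that degrees outside
`ℕ[I]` must be seen to carry nothing. -/
theorem wordSpan_eq_bot (g : I → A) {d : I → ℤ} (hd : ∀ n : I → ℕ, toZ n ≠ d) :
    wordSpan g d = ⊥ := by
  rw [wordSpan, Submodule.span_eq_bot]
  rintro x ⟨w, h, -⟩
  exact (hd _ h).elim

theorem map_wordSpan {B : Type*} [Ring B] [Algebra Qvt B] (f : A →ₐ[Qvt] B) (g : I → A)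
    (d : I → ℤ) : (wordSpan g d).map f.toLinearMap = wordSpan (fun i => f (g i)) d := by
  rw [wordSpan, wordSpan, Submodule.map_span]
  congr 1
  ext x
  simp only [Set.mem_image, Set.mem_ofPred_eq, AlgHom.toLinearMap_apply]
  constructor
  · rintro ⟨_, ⟨w, h, rfl⟩, rfl⟩
    exact ⟨w, h, by rw [map_list_prod, List.map_map]; rfl⟩
  · rintro ⟨w, h, rfl⟩
    exact ⟨_, ⟨w, h, rfl⟩, by rw [map_list_prod, List.map_map]; rfl⟩

/-- An element which `ψ`-commutes with the letters `ψ`-commutes with homogeneous elements. -/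
theorem comm_wordSpan {g : I → A} {k : A} {ψ : (I → ℤ) → Qvt} (h0 : ψ 0 = 1)
    (hadd : ∀ a b, ψ (a + b) = ψ a * ψ b) (h : ∀ j, k * g j = ψ (sg j) • (g j * k))
    {d : I → ℤ} {x : A} (hx : x ∈ wordSpan g d) : k * x = ψ d • (x * k) := by
  induction hx using Submodule.span_induction with
  | mem x hx =>
    obtain ⟨w, rfl, rfl⟩ := hx
    induction w with
    | nil => simp [toZ_wordDeg_nil, h0]
    | cons j w ih =>
      rw [List.map_cons, List.prod_cons, ← mul_assoc, h, smul_mul_assoc, mul_assoc, ih,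
        toZ_wordDeg_cons, hadd, mul_smul_comm, smul_smul, mul_assoc]
  | zero => simp
  | add x y _ _ hx hy => rw [mul_add, hx, hy, add_mul, smul_add]
  | smul a x _ hx => rw [mul_smul_comm, hx, smul_mul_assoc, smul_comm]

/-- The skew derivation with `g j w ↦ δ_{ij} w + c_j g j (∂ w)`, on words. -/
def skewDer (g : I → A) (i : I) (c : I → Qvt) : List I → A
  | [] => 0
  | j :: w => (if i = j then (1 : Qvt) else 0) • (w.map g).prod + c j • (g j * skewDer g i c w)

theorem skewDer_mem (g : I → A) (i : I) (c : I → Qvt) (w : List I) :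
    skewDer g i c w ∈ wordSpan g (toZ (wordDeg w) - sg i) := by
  induction w with
  | nil => exact zero_mem _
  | cons j w ih =>
    refine add_mem ?_ (Submodule.smul_mem _ _ ?_)
    · split_ifs with h
      · subst h
        rw [toZ_wordDeg_cons, add_sub_cancel_left]
        exact Submodule.smul_mem _ _ (word_mem_wordSpan g w)
      · simp
    · rw [toZ_wordDeg_cons, add_sub_assoc]
      exact mul_mem_wordSpan g j ih

end Words

/-! ### The skew-Hopf pairing: values on generators and adjoints of multiplication by a generator.
-/

section PairingLemmas

variable {I : Type*} [Fintype I] [DecidableEq I] (D : Datum I)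

theorem comul_gen (x : Gen I) : comul D (U.gen D x) = comulGen D x := U.lift_gen D _ _ x

theorem counit_gen (x : Gen I) : counit D (U.gen D x) = counitGen x := U.lift_gen D _ _ x

theorem K_mem (i : I) : U.K D i ∈ Ugeq D := Algebra.subset_adjoin (Or.inl (Or.inr ⟨i, rfl⟩))

theorem K'_mem (i : I) : U.K' D i ∈ Uleq D := Algebra.subset_adjoin (Or.inl (Or.inr ⟨i, rfl⟩))

/-- `E_i` as an element of `U_{≥0}`. -/
def Egeq (i : I) : Ugeq D := ⟨U.E D i, E_mem D i⟩

/-- `K_i` as an element of `U_{≥0}`. -/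
def KgeqGen (i : I) : Ugeq D := ⟨U.K D i, K_mem D i⟩

/-- `F_i` as an element of `U_{≤0}`. -/
def Fleq (i : I) : Uleq D := ⟨U.F D i, F_mem D i⟩

/-- `K'_i` as an element of `U_{≤0}`. -/
def K'leqGen (i : I) : Uleq D := ⟨U.K' D i, K'_mem D i⟩

theorem noncommProd_zpow_sg {G : Type*} [Monoid G] (u : I → Gˣ) (i : I) (s : Finset I)
    (h : (s : Set I).Pairwise
      (Function.onFun Commute fun j => ((u j ^ (sg i j) : Gˣ) : G))) :
    s.noncommProd (fun j => ((u j ^ (sg i j) : Gˣ) : G)) h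
      = ((if i ∈ s then u i else 1 : Gˣ) : G) := by
  induction s using Finset.induction_on with
  | empty => simp
  | insert j s hj ih =>
    rw [Finset.noncommProd_insert_of_notMem _ _ _ _ hj, ih]
    by_cases hij : i = j
    · subst hij; simp [sg, hj]
    · simp [sg, hij, Ne.symm hij]

theorem Kgeq_sg (i : I) : Kgeq D (sg i) = KgeqGen D i :=
  Subtype.ext ((noncommProd_zpow_sg (Kunit D) i _ (Kunit_comm D _ _)).trans (by simp; rfl))

theorem K'leq_sg (i : I) : K'leq D (sg i) = K'leqGen D i :=
  Subtype.ext ((noncommProd_zpow_sg (K'unit D) i _ (K'unit_comm D _ _)).trans (by simp; rfl))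

theorem Kgeq_zero : Kgeq D 0 = 1 := Subtype.ext <|
  (Finset.noncommProd_eq_pow_card _ _ (Kunit_comm D 0 _) 1 (by simp)).trans (one_pow _)

theorem K'leq_zero : K'leq D 0 = 1 := Subtype.ext <|
  (Finset.noncommProd_eq_pow_card _ _ (K'unit_comm D 0 _) 1 (by simp)).trans (one_pow _)

/-- The product axioms of the pairing need a lift of `Δ(x)` to `U_{≥0} ⊗ U_{≥0}`. The elements for
which one exists form a subalgebra, so generators suffice. -/
theorem exists_comul_geq (x : Ugeq D) : ∃ z : Ugeq D ⊗[Qvt] Ugeq D,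
    Algebra.TensorProduct.map (Ugeq D).val (Ugeq D).val z = comul D x := by
  suffices h : Ugeq D ≤
      (Algebra.TensorProduct.map (Ugeq D).val (Ugeq D).val).range.comap (comul D) from h x.2
  refine Algebra.adjoin_le ?_
  rintro _ ((⟨i, rfl⟩ | ⟨i, rfl⟩) | ⟨i, rfl⟩)
  · refine ⟨Egeq D i ⊗ₜ 1 + KgeqGen D i ⊗ₜ Egeq D i, ?_⟩
    simp [U.E, comul_gen, comulGen, Egeq, KgeqGen]
  · refine ⟨KgeqGen D i ⊗ₜ KgeqGen D i, ?_⟩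
    simp [U.K, comul_gen, comulGen, KgeqGen]
  · refine ⟨⟨U.Kinv D i, Algebra.subset_adjoin (Or.inr ⟨i, rfl⟩)⟩ ⊗ₜ
      ⟨U.Kinv D i, Algebra.subset_adjoin (Or.inr ⟨i, rfl⟩)⟩, ?_⟩
    simp [U.Kinv, comul_gen, comulGen]

theorem exists_comul_leq (y : Uleq D) : ∃ z : Uleq D ⊗[Qvt] Uleq D,
    Algebra.TensorProduct.map (Uleq D).val (Uleq D).val z = comul D y := by
  suffices h : Uleq D ≤
      (Algebra.TensorProduct.map (Uleq D).val (Uleq D).val).range.comap (comul D) from h y.2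
  refine Algebra.adjoin_le ?_
  rintro _ ((⟨i, rfl⟩ | ⟨i, rfl⟩) | ⟨i, rfl⟩)
  · refine ⟨1 ⊗ₜ Fleq D i + Fleq D i ⊗ₜ K'leqGen D i, ?_⟩
    simp [U.F, comul_gen, comulGen, Fleq, K'leqGen]
  · refine ⟨K'leqGen D i ⊗ₜ K'leqGen D i, ?_⟩
    simp [U.K', comul_gen, comulGen, K'leqGen]
  · refine ⟨⟨U.K'inv D i, Algebra.subset_adjoin (Or.inr ⟨i, rfl⟩)⟩ ⊗ₜ
      ⟨U.K'inv D i, Algebra.subset_adjoin (Or.inr ⟨i, rfl⟩)⟩, ?_⟩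
    simp [U.K'inv, comul_gen, comulGen]

theorem comul_Egeq (i : I) : Algebra.TensorProduct.map (Ugeq D).val (Ugeq D).val
    (Egeq D i ⊗ₜ 1 + KgeqGen D i ⊗ₜ Egeq D i) = comul D (Egeq D i) := by
  simp [U.E, comul_gen, comulGen, Egeq, KgeqGen]

theorem comul_Fleq (i : I) : Algebra.TensorProduct.map (Uleq D).val (Uleq D).val
    (1 ⊗ₜ Fleq D i + Fleq D i ⊗ₜ K'leqGen D i) = comul D (Fleq D i) := by
  simp [U.F, comul_gen, comulGen, Fleq, K'leqGen]

theorem Uplus_eq_wordSpan (n : I → ℕ) : Uplus D n = wordSpan (U.E D) (toZ n) := by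
  rw [Uplus, wordSpan]
  congr 1; ext x
  simp only [toZ, funext_iff, Nat.cast_inj]

theorem Uminus_eq_wordSpan (n : I → ℕ) : Uminus D n = wordSpan (U.F D) (toZ n) := by
  rw [Uminus, wordSpan]
  congr 1; ext x
  simp only [toZ, funext_iff, Nat.cast_inj]

theorem coe_mem_wordSpan_E {x : Ugeq D} {d : I → ℤ} :
    (x : U D) ∈ wordSpan (U.E D) d ↔ x ∈ wordSpan (Egeq D) d := by
  rw [show wordSpan (U.E D) d = (wordSpan (Egeq D) d).map (Ugeq D).val.toLinearMap from
    (map_wordSpan (Ugeq D).val (Egeq D) d).symm]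
  exact Submodule.mem_map.trans ⟨fun ⟨y, hy, e⟩ => Subtype.ext e ▸ hy, fun h => ⟨x, h, rfl⟩⟩

theorem coe_mem_wordSpan_F {y : Uleq D} {d : I → ℤ} :
    (y : U D) ∈ wordSpan (U.F D) d ↔ y ∈ wordSpan (Fleq D) d := by
  rw [show wordSpan (U.F D) d = (wordSpan (Fleq D) d).map (Uleq D).val.toLinearMap from
    (map_wordSpan (Uleq D).val (Fleq D) d).symm]
  exact Submodule.mem_map.trans ⟨fun ⟨y, hy, e⟩ => Subtype.ext e ▸ hy, fun h => ⟨y, h, rfl⟩⟩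

namespace IsSkewHopfPairing

variable {D} {φ : Ugeq D →ₗ[Qvt] Uleq D →ₗ[Qvt] Qvt} (h : IsSkewHopfPairing D φ)
include h

theorem apply_one_one : φ 1 1 = 1 := by rw [h.one_left]; simp

theorem apply_E_one (i : I) : φ (Egeq D i) 1 = 0 := by
  rw [h.one_right]; exact counit_gen D _

theorem apply_K_one (i : I) : φ (KgeqGen D i) 1 = 1 := by
  rw [h.one_right]; exact counit_gen D _

theorem apply_one_F (i : I) : φ 1 (Fleq D i) = 0 := by
  rw [h.one_left]; exact counit_gen D _

theorem apply_one_K' (i : I) : φ 1 (K'leqGen D i) = 1 := by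
  rw [h.one_left]; exact counit_gen D _

theorem K_K'_wordSpan (m n : I → ℤ) {d e : I → ℤ} {x : Ugeq D} {y : Uleq D}
    (hx : x ∈ wordSpan (Egeq D) d) (hy : y ∈ wordSpan (Fleq D) e) :
    φ (Kgeq D m * x) (K'leq D n * y)
      = D.brace m n * D.brace m e * D.brace d n * φ x y := by
  by_cases hd : ∃ a, toZ a = d
  · by_cases he : ∃ b, toZ b = e
    · obtain ⟨a, rfl⟩ := hd
      obtain ⟨b, rfl⟩ := he
      exact h.K_K' m n a b x y (by rwa [Uplus_eq_wordSpan, coe_mem_wordSpan_E])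
        (by rwa [Uminus_eq_wordSpan, coe_mem_wordSpan_F])
    · rw [wordSpan_eq_bot _ (not_exists.1 he), Submodule.mem_bot] at hy
      simp [hy]
  · rw [wordSpan_eq_bot _ (not_exists.1 hd), Submodule.mem_bot] at hx
    simp [hx]

theorem apply_Kgeq_K'leq (m n : I → ℤ) : φ (Kgeq D m) (K'leq D n) = D.brace m n := by
  have h0 : (1 : Ugeq D) ∈ wordSpan (Egeq D) 0 := by
    simpa [toZ_wordDeg_nil] using word_mem_wordSpan (Egeq D) []
  have h1 : (1 : Uleq D) ∈ wordSpan (Fleq D) 0 := by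
    simpa [toZ_wordDeg_nil] using word_mem_wordSpan (Fleq D) []
  simpa [h.apply_one_one, D.brace_zero_left, D.brace_zero_right] using h.K_K'_wordSpan m n h0 h1

theorem apply_K_K' (i j : I) : φ (KgeqGen D i) (K'leqGen D j) = D.brace (sg i) (sg j) := by
  rw [← Kgeq_sg, ← K'leq_sg, h.apply_Kgeq_K'leq]

theorem apply_K_F (i j : I) : φ (KgeqGen D i) (Fleq D j) = 0 := by
  have h0 : (1 : Ugeq D) ∈ wordSpan (Egeq D) 0 := by
    simpa [toZ_wordDeg_nil] using word_mem_wordSpan (Egeq D) []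
  have h1 : Fleq D j ∈ wordSpan (Fleq D) (toZ (wordDeg [j])) := by
    simpa using word_mem_wordSpan (Fleq D) [j]
  simpa [h.apply_one_F, K'leq_zero, Kgeq_sg] using h.K_K'_wordSpan (sg i) 0 h0 h1

theorem apply_E_K' (i j : I) : φ (Egeq D i) (K'leqGen D j) = 0 := by
  have h0 : (1 : Uleq D) ∈ wordSpan (Fleq D) 0 := by
    simpa [toZ_wordDeg_nil] using word_mem_wordSpan (Fleq D) []
  have h1 : Egeq D i ∈ wordSpan (Egeq D) (toZ (wordDeg [i])) := by
    simpa using word_mem_wordSpan (Egeq D) [i]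
  simpa [h.apply_E_one, Kgeq_zero, K'leq_sg] using h.K_K'_wordSpan 0 (sg j) h1 h0

theorem apply_E_F (i j : I) : φ (Egeq D i) (Fleq D j)
    = D.pairEF i * (if i = j then (1 : Qvt) else 0) := by
  refine (h.E_F i j).trans ?_
  split_ifs
  · rw [mul_one]; rfl
  · simp

theorem mul_apply_F (x x' : Ugeq D) (j : I) : φ (x * x') (Fleq D j)
    = φ x (Fleq D j) * φ x' 1 + φ x (K'leqGen D j) * φ x' (Fleq D j) := by
  rw [h.mul_left x x' _ (1 ⊗ₜ Fleq D j + Fleq D j ⊗ₜ K'leqGen D j) (comul_Fleq D j)]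
  simp

theorem apply_E_mul (y y' : Uleq D) (j : I) : φ (Egeq D j) (y * y')
    = φ (Egeq D j) y * φ 1 y' + φ (KgeqGen D j) y * φ (Egeq D j) y' := by
  rw [h.mul_right _ y y' (Egeq D j ⊗ₜ 1 + KgeqGen D j ⊗ₜ Egeq D j) (comul_Egeq D j)]
  simp

/-- Expand with `Δ(E_i x) = (E_i ⊗ 1 + K_i ⊗ E_i) Δ(x)` paired against `F_j ⊗ y`. For a first leg
`a` of `Δ(x)`, `(E_i a, F_j)` reduces to `δ_{ij} c_i ε(a)` and `(K_i a, F_j)` to `{i, j} (a, F_j)`.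
This is one step of a twisted Leibniz recursion, and it does not require `x` to be homogeneous. -/
theorem apply_E_mul_left {i j : I} {y q : Uleq D}
    (hq : ∀ x, φ (Egeq D i * x) y = D.pairEF i * φ x q) (x : Ugeq D) :
    φ (Egeq D i * x) (Fleq D j * y) = D.pairEF i * φ x ((if i = j then (1 : Qvt) else 0) • y
      + D.brace (sg i) (sg j) • (Fleq D j * q)) := by
  obtain ⟨z, hz⟩ := exists_comul_geq D x
  have h1 := h.mul_right x 1 y z hz
  have h2 := h.mul_right x (Fleq D j) q z hz
  rw [one_mul] at h1
  rw [map_add, map_smul, map_smul, h1, h2, h.mul_right _ (Fleq D j) y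
    ((Egeq D i ⊗ₜ 1 + KgeqGen D i ⊗ₜ Egeq D i) * z)]
  · clear hz h1 h2
    induction z using TensorProduct.induction_on with
    | zero => simp
    | add z z' hz hz' =>
      rw [mul_add, map_add, map_add, hz, hz']
      simp only [map_add, smul_eq_mul]
      ring
    | tmul a b =>
      simp only [add_mul, Algebra.TensorProduct.tmul_mul_tmul, map_add, TensorProduct.map_tmul,
        LinearMap.flip_apply, LinearMap.mul'_apply, one_mul, h.mul_apply_F, h.apply_E_F,
        h.apply_E_K', h.apply_K_K', h.apply_K_F, hq, smul_eq_mul]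
      ring
  -- `Δ` is multiplicative, so the product of the two lifts is a lift of `Δ(E_i x)`.
  · change Algebra.TensorProduct.map (Ugeq D).val (Ugeq D).val _ = _
    rw [map_mul, comul_Egeq, hz, ← map_mul]; rfl

/-- Now `E_i` stands on the right: `(a E_i, F_j) = δ_{ij} c_i (a, K'_j)` and `(a K_i, F_j) = (a,
F_j)`. Hence `K'_i` appears in front of `y`, and the second term carries no twist. -/
theorem apply_E_mul_right {i j : I} {y p : Uleq D}
    (hp : ∀ x, φ (x * Egeq D i) y = D.pairEF i * φ x p) (x : Ugeq D) :
    φ (x * Egeq D i) (Fleq D j * y) = D.pairEF i * φ x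
      ((if i = j then (1 : Qvt) else 0) • (K'leqGen D i * y) + Fleq D j * p) := by
  obtain ⟨z, hz⟩ := exists_comul_geq D x
  have h1 := h.mul_right x (K'leqGen D i) y z hz
  have h2 := h.mul_right x (Fleq D j) p z hz
  rw [map_add, map_smul, h1, h2, h.mul_right _ (Fleq D j) y
    (z * (Egeq D i ⊗ₜ 1 + KgeqGen D i ⊗ₜ Egeq D i))]
  · clear hz h1 h2
    induction z using TensorProduct.induction_on with
    | zero => simp
    | add z z' hz hz' =>
      rw [add_mul, map_add, map_add, hz, hz']
      simp only [map_add, smul_eq_mul]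
      ring
    | tmul a b =>
      simp only [mul_add, Algebra.TensorProduct.tmul_mul_tmul, map_add, TensorProduct.map_tmul,
        LinearMap.flip_apply, LinearMap.mul'_apply, mul_one, h.mul_apply_F, h.apply_E_F,
        h.apply_E_one, h.apply_K_one, h.apply_K_F, hp, smul_eq_mul]
      split_ifs with hij
      · subst hij; ring
      · ring
  · change Algebra.TensorProduct.map (Ugeq D).val (Ugeq D).val _ = _
    rw [map_mul, comul_Egeq, hz, ← map_mul]; rfl

/-- The mirror image of `apply_E_mul_left`, by expanding `Δ(F_i y)`; the twist is `{j, i} = (K_j,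
K'_i)_φ`, because the product axiom in the first variable uses `Δ^op`. -/
theorem apply_mul_left_F {i j : I} {x s : Ugeq D}
    (hs : ∀ y, φ x (Fleq D i * y) = D.pairEF i * φ s y) (y : Uleq D) :
    φ (Egeq D j * x) (Fleq D i * y) = D.pairEF i * φ ((if i = j then (1 : Qvt) else 0) • x
      + D.brace (sg j) (sg i) • (Egeq D j * s)) y := by
  obtain ⟨z, hz⟩ := exists_comul_leq D y
  have h1 := h.mul_left 1 x y z hz
  have h2 := h.mul_left (Egeq D j) s y z hz
  rw [one_mul] at h1
  rw [map_add, map_smul, map_smul, LinearMap.add_apply, LinearMap.smul_apply,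
    LinearMap.smul_apply, h1, h2, h.mul_left (Egeq D j) x _
    ((1 ⊗ₜ Fleq D i + Fleq D i ⊗ₜ K'leqGen D i) * z)]
  · clear hz h1 h2
    induction z using TensorProduct.induction_on with
    | zero => simp
    | add z z' hz hz' =>
      rw [mul_add, map_add, map_add, map_add, hz, hz']
      simp only [map_add, smul_eq_mul]
      ring
    | tmul a b =>
      simp only [add_mul, Algebra.TensorProduct.tmul_mul_tmul, map_add, TensorProduct.map_tmul,
        TensorProduct.comm_tmul, LinearMap.mul'_apply, one_mul, h.apply_E_mul, h.apply_E_F,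
        h.apply_E_K', h.apply_K_K', h.apply_K_F, hs, smul_eq_mul]
      by_cases hij : i = j
      · subst hij; simp only [if_true]; ring
      · simp only [if_neg hij, if_neg (Ne.symm hij)]; ring
  · change Algebra.TensorProduct.map (Uleq D).val (Uleq D).val _ = _
    rw [map_mul, comul_Fleq, hz, ← map_mul]; rfl

theorem apply_mul_right_F {i j : I} {x r : Ugeq D}
    (hr : ∀ y, φ x (y * Fleq D i) = D.pairEF i * φ r y) (y : Uleq D) :
    φ (Egeq D j * x) (y * Fleq D i) = D.pairEF i * φ
      ((if i = j then (1 : Qvt) else 0) • (KgeqGen D i * x) + Egeq D j * r) y := by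
  obtain ⟨z, hz⟩ := exists_comul_leq D y
  have h1 := h.mul_left (KgeqGen D i) x y z hz
  have h2 := h.mul_left (Egeq D j) r y z hz
  rw [map_add, map_smul, LinearMap.add_apply, LinearMap.smul_apply,
    h1, h2, h.mul_left (Egeq D j) x _ (z * (1 ⊗ₜ Fleq D i + Fleq D i ⊗ₜ K'leqGen D i))]
  · clear hz h1 h2
    induction z using TensorProduct.induction_on with
    | zero => simp
    | add z z' hz hz' =>
      rw [add_mul, map_add, map_add, map_add, hz, hz']
      simp only [map_add, smul_eq_mul]
      ring
    | tmul a b =>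
      simp only [mul_add, Algebra.TensorProduct.tmul_mul_tmul, map_add, TensorProduct.map_tmul,
        TensorProduct.comm_tmul, LinearMap.mul'_apply, mul_one, h.apply_E_mul, h.apply_E_F,
        h.apply_one_F, h.apply_one_K', h.apply_E_K', hr, smul_eq_mul]
      by_cases hij : i = j
      · subst hij; simp only [if_true]; ring
      · simp only [if_neg hij, if_neg (Ne.symm hij)]; ring
  · change Algebra.TensorProduct.map (Uleq D).val (Uleq D).val _ = _
    rw [map_mul, comul_Fleq, hz, ← map_mul]; rfl

end IsSkewHopfPairing

end PairingLemmas

/-! ### Commutators with `E_i` and `F_i` expressed through adjoints for the pairing. -/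

section Commutators

variable {I : Type*} [Fintype I] [DecidableEq I] {D : Datum I}

namespace IsSkewHopfPairing

variable {φ : Ugeq D →ₗ[Qvt] Uleq D →ₗ[Qvt] Qvt} (h : IsSkewHopfPairing D φ)
include h

theorem apply_E_mul_one (i : I) (x : Ugeq D) : φ (Egeq D i * x) 1 = 0 := by
  rw [h.one_right]
  have : counit D (U.E D i) = 0 := counit_gen D _
  simp [Egeq, this]

theorem apply_mul_E_one (i : I) (x : Ugeq D) : φ (x * Egeq D i) 1 = 0 := by
  rw [h.one_right]
  have : counit D (U.E D i) = 0 := counit_gen D _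
  simp [Egeq, this]

theorem apply_one_F_mul (i : I) (y : Uleq D) : φ 1 (Fleq D i * y) = 0 := by
  rw [h.one_left]
  have : counit D (U.F D i) = 0 := counit_gen D _
  simp [Fleq, this]

theorem apply_one_mul_F (i : I) (y : Uleq D) : φ 1 (y * Fleq D i) = 0 := by
  rw [h.one_left]
  have : counit D (U.F D i) = 0 := counit_gen D _
  simp [Fleq, this]

theorem apply_E_mul_word (i : I) (w : List I) (x : Ugeq D) :
    φ (Egeq D i * x) (w.map (Fleq D)).prod
      = D.pairEF i * φ x (skewDer (Fleq D) i (fun j => D.brace (sg i) (sg j)) w) := by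
  induction w generalizing x with
  | nil => simp [skewDer, h.apply_E_mul_one]
  | cons j w ih => rw [List.map_cons, List.prod_cons, h.apply_E_mul_left ih, skewDer]

-- Moving `K'_i` past `F_j` produces `{j, i}`, which cancels the twist `{j, i}⁻¹`. So `K'_i` times
-- this skew derivation obeys the untwisted recursion of `apply_E_mul_right`.
omit h in
theorem K'_mul_skewDer (i j : I) (w : List I) :
    K'leqGen D i * skewDer (Fleq D) i (fun j => (D.brace (sg j) (sg i))⁻¹) (j :: w)
      = (if i = j then (1 : Qvt) else 0) • (K'leqGen D i * (w.map (Fleq D)).prod)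
        + Fleq D j *
          (K'leqGen D i * skewDer (Fleq D) i (fun j => (D.brace (sg j) (sg i))⁻¹) w) := by
  have hc : K'leqGen D i * Fleq D j = D.brace (sg j) (sg i) • (Fleq D j * K'leqGen D i) :=
    Subtype.ext (U.K'_F_brace D i j)
  rw [skewDer, mul_add, mul_smul_comm, mul_smul_comm, ← mul_assoc _ (Fleq D j), hc,
    smul_mul_assoc, smul_smul, inv_mul_cancel₀ (D.brace_ne_zero _ _), one_smul, mul_assoc]

omit h in
theorem K_mul_skewDer (i j : I) (w : List I) :
    KgeqGen D i * skewDer (Egeq D) i (fun j => (D.brace (sg i) (sg j))⁻¹) (j :: w)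
      = (if i = j then (1 : Qvt) else 0) • (KgeqGen D i * (w.map (Egeq D)).prod)
        + Egeq D j *
          (KgeqGen D i * skewDer (Egeq D) i (fun j => (D.brace (sg i) (sg j))⁻¹) w) := by
  have hc : KgeqGen D i * Egeq D j = D.brace (sg i) (sg j) • (Egeq D j * KgeqGen D i) :=
    Subtype.ext (U.K_E_brace D i j)
  rw [skewDer, mul_add, mul_smul_comm, mul_smul_comm, ← mul_assoc _ (Egeq D j), hc,
    smul_mul_assoc, smul_smul, inv_mul_cancel₀ (D.brace_ne_zero _ _), one_smul, mul_assoc]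

theorem apply_mul_E_word (i : I) (w : List I) (x : Ugeq D) :
    φ (x * Egeq D i) (w.map (Fleq D)).prod = D.pairEF i * φ x (K'leqGen D i *
      skewDer (Fleq D) i (fun j => (D.brace (sg j) (sg i))⁻¹) w) := by
  induction w generalizing x with
  | nil => simp [skewDer, h.apply_mul_E_one]
  | cons j w ih =>
    rw [List.map_cons, List.prod_cons, h.apply_E_mul_right ih, K'_mul_skewDer]

theorem apply_word_F_mul (i : I) (w : List I) (y : Uleq D) :
    φ (w.map (Egeq D)).prod (Fleq D i * y)
      = D.pairEF i * φ (skewDer (Egeq D) i (fun j => D.brace (sg j) (sg i)) w) y := by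
  induction w generalizing y with
  | nil => simp [skewDer, h.apply_one_F_mul]
  | cons j w ih => rw [List.map_cons, List.prod_cons, h.apply_mul_left_F ih, skewDer]

theorem apply_word_mul_F (i : I) (w : List I) (y : Uleq D) :
    φ (w.map (Egeq D)).prod (y * Fleq D i) = D.pairEF i * φ (KgeqGen D i *
      skewDer (Egeq D) i (fun j => (D.brace (sg i) (sg j))⁻¹) w) y := by
  induction w generalizing y with
  | nil => simp [skewDer, h.apply_one_mul_F]
  | cons j w ih =>
    rw [List.map_cons, List.prod_cons, h.apply_mul_right_F ih, K_mul_skewDer]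

-- Induction with `[E_i, F_j Y] = [E_i, F_j] Y + F_j [E_i, Y]`. The twists are those for which
-- `K'_i` and `K_i` pass `F_j` without leaving a scalar, and they are the same ones that occur in
-- `apply_mul_E_word` and `apply_E_mul_word`: this coincidence is the heart of the argument.
omit h in
theorem E_comm_word (i : I) (w : List I) :
    U.E D i * ((w.map (Fleq D)).prod : Uleq D) - ((w.map (Fleq D)).prod : Uleq D) * U.E D i
      = D.pairEF i • (U.K' D i *
          (skewDer (Fleq D) i (fun j => (D.brace (sg j) (sg i))⁻¹) w : Uleq D)
        - U.K D i * (skewDer (Fleq D) i (fun j => D.brace (sg i) (sg j)) w : Uleq D)) := by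
  induction w with
  | nil => simp [skewDer]
  | cons j w ih =>
    have h1 := congrArg (Subtype.val) (K'_mul_skewDer (D := D) i j w)
    have h2 : U.K D i * (skewDer (Fleq D) i (fun j => D.brace (sg i) (sg j)) (j :: w) : Uleq D)
        = (if i = j then (1 : Qvt) else 0) • (U.K D i * ((w.map (Fleq D)).prod : Uleq D))
        + U.F D j *
          (U.K D i * (skewDer (Fleq D) i (fun j => D.brace (sg i) (sg j)) w : Uleq D)) := by
      rw [skewDer]
      change U.K D i * ((if i = j then (1 : Qvt) else 0) • ((w.map (Fleq D)).prod : Uleq D).1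
        + D.brace (sg i) (sg j) • (U.F D j * _)) = _
      rw [mul_add, mul_smul_comm, mul_smul_comm, ← mul_assoc _ (U.F D j), U.K_F_brace,
        smul_mul_assoc, smul_smul, mul_inv_cancel₀ (D.brace_ne_zero _ _), one_smul, mul_assoc]
    change U.K' D i * (skewDer (Fleq D) i _ (j :: w) : Uleq D).1 =
      (if i = j then (1 : Qvt) else 0) • (U.K' D i * ((w.map (Fleq D)).prod : Uleq D).1)
        + U.F D j * (U.K' D i * (skewDer (Fleq D) i _ w : Uleq D).1) at h1
    rw [h1, h2, List.map_cons, List.prod_cons]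
    change U.E D i * (U.F D j * ((w.map (Fleq D)).prod : Uleq D).1)
      - (U.F D j * ((w.map (Fleq D)).prod : Uleq D).1) * U.E D i = _
    generalize ((w.map (Fleq D)).prod : Uleq D).1 = Y at ih ⊢
    have e : U.E D i * (U.F D j * Y) - U.F D j * Y * U.E D i
        = (U.E D i * U.F D j - U.F D j * U.E D i) * Y + U.F D j * (U.E D i * Y - Y * U.E D i) := by
      noncomm_ring
    rw [e, ih, U.E_F_pairEF]
    split_ifs with hij
    · simp only [one_smul, smul_mul_assoc, mul_smul_comm, ← smul_add]
      congr 1; noncomm_ring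
    · simp only [zero_smul, zero_add, zero_mul, mul_smul_comm, mul_sub]

omit h in
theorem word_comm_F (i : I) (w : List I) :
    ((w.map (Egeq D)).prod : Ugeq D) * U.F D i - U.F D i * ((w.map (Egeq D)).prod : Ugeq D)
      = D.pairEF i • (U.K' D i *
          (skewDer (Egeq D) i (fun j => D.brace (sg j) (sg i)) w : Ugeq D)
        - U.K D i * (skewDer (Egeq D) i (fun j => (D.brace (sg i) (sg j))⁻¹) w : Ugeq D)) := by
  induction w with
  | nil => simp [skewDer]
  | cons j w ih =>
    have h1 := congrArg (Subtype.val) (K_mul_skewDer (D := D) i j w)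
    have h2 : U.K' D i * (skewDer (Egeq D) i (fun j => D.brace (sg j) (sg i)) (j :: w) : Ugeq D)
        = (if i = j then (1 : Qvt) else 0) • (U.K' D i * ((w.map (Egeq D)).prod : Ugeq D))
        + U.E D j *
          (U.K' D i * (skewDer (Egeq D) i (fun j => D.brace (sg j) (sg i)) w : Ugeq D)) := by
      rw [skewDer]
      change U.K' D i * ((if i = j then (1 : Qvt) else 0) • ((w.map (Egeq D)).prod : Ugeq D).1
        + D.brace (sg j) (sg i) • (U.E D j * _)) = _
      rw [mul_add, mul_smul_comm, mul_smul_comm, ← mul_assoc _ (U.E D j), U.K'_E_brace,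
        smul_mul_assoc, smul_smul, mul_inv_cancel₀ (D.brace_ne_zero _ _), one_smul, mul_assoc]
    change U.K D i * (skewDer (Egeq D) i _ (j :: w) : Ugeq D).1 =
      (if i = j then (1 : Qvt) else 0) • (U.K D i * ((w.map (Egeq D)).prod : Ugeq D).1)
        + U.E D j * (U.K D i * (skewDer (Egeq D) i _ w : Ugeq D).1) at h1
    rw [h1, h2, List.map_cons, List.prod_cons]
    change (U.E D j * ((w.map (Egeq D)).prod : Ugeq D).1) * U.F D i
      - U.F D i * (U.E D j * ((w.map (Egeq D)).prod : Ugeq D).1) = _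
    generalize ((w.map (Egeq D)).prod : Ugeq D).1 = X at ih ⊢
    have e : U.E D j * X * U.F D i - U.F D i * (U.E D j * X)
        = (U.E D j * U.F D i - U.F D i * U.E D j) * X + U.E D j * (X * U.F D i - U.F D i * X) := by
      noncomm_ring
    rw [e, ih, U.E_F_pairEF]
    by_cases hij : i = j
    · subst hij
      simp only [if_true, one_smul, smul_mul_assoc, mul_smul_comm, ← smul_add]
      congr 1; noncomm_ring
    · simp only [if_neg hij, if_neg (Ne.symm hij), zero_smul, zero_add, zero_mul, mul_smul_comm,
        mul_sub]

/-- Commutation of `E_i` with `U⁻`, in terms of the adjoints of multiplication by `E_i`. -/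
theorem exists_E_comm (i : I) {d : I → ℤ} {y : Uleq D} (hy : y ∈ wordSpan (Fleq D) d) :
    ∃ p ∈ wordSpan (Fleq D) (d - sg i), ∃ q ∈ wordSpan (Fleq D) (d - sg i),
      U.E D i * (y : U D) - y * U.E D i = D.pairEF i • (U.K' D i * (p : U D) - U.K D i * q) ∧
      (∀ x, φ (Egeq D i * x) y = D.pairEF i * φ x q) ∧
      ∀ x, φ (x * Egeq D i) y = D.pairEF i * φ x (K'leqGen D i * p) := by
  induction hy using Submodule.span_induction with
  | mem y hy =>
    obtain ⟨w, rfl, rfl⟩ := hy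
    -- On a monomial the witnesses are its skew derivatives; for a linear combination, the same
    -- combination of witnesses works, with no claim that it depends only on `y`.
    exact ⟨_, skewDer_mem _ i _ w, _, skewDer_mem _ i _ w, E_comm_word i w,
      h.apply_E_mul_word i w, h.apply_mul_E_word i w⟩
  | zero => exact ⟨0, zero_mem _, 0, zero_mem _, by simp, by simp, by simp⟩
  | add y y' _ _ hy hy' =>
    obtain ⟨p, hp, q, hq, h1, h2, h3⟩ := hy
    obtain ⟨p', hp', q', hq', h1', h2', h3'⟩ := hy'
    refine ⟨p + p', add_mem hp hp', q + q', add_mem hq hq', ?_, fun x => ?_, fun x => ?_⟩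
    · simp only [AddMemClass.coe_add, mul_add, add_mul, add_sub_add_comm, h1, h1', smul_add]
    · rw [map_add, h2, h2', map_add, mul_add]
    · rw [map_add, h3, h3', mul_add (K'leqGen D i), map_add, mul_add]
  | smul a y _ hy =>
    obtain ⟨p, hp, q, hq, h1, h2, h3⟩ := hy
    refine ⟨a • p, Submodule.smul_mem _ a hp, a • q, Submodule.smul_mem _ a hq, ?_,
      fun x => ?_, fun x => ?_⟩
    · simp only [SetLike.val_smul, mul_smul_comm, smul_mul_assoc, ← smul_sub, h1]
      rw [smul_comm]
    · rw [map_smul, h2, map_smul, smul_eq_mul, smul_eq_mul]; ring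
    · rw [map_smul, h3, mul_smul_comm, map_smul, smul_eq_mul, smul_eq_mul]; ring

/-- Commutation of `F_i` with `U⁺`, in terms of the adjoints of multiplication by `F_i`. -/
theorem exists_comm_F (i : I) {d : I → ℤ} {x : Ugeq D} (hx : x ∈ wordSpan (Egeq D) d) :
    ∃ s ∈ wordSpan (Egeq D) (d - sg i), ∃ r ∈ wordSpan (Egeq D) (d - sg i),
      (x : U D) * U.F D i - U.F D i * x = D.pairEF i • (U.K' D i * (s : U D) - U.K D i * r) ∧
      (∀ y, φ x (Fleq D i * y) = D.pairEF i * φ s y) ∧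
      ∀ y, φ x (y * Fleq D i) = D.pairEF i * φ (KgeqGen D i * r) y := by
  induction hx using Submodule.span_induction with
  | mem x hx =>
    obtain ⟨w, rfl, rfl⟩ := hx
    exact ⟨_, skewDer_mem _ i _ w, _, skewDer_mem _ i _ w, word_comm_F i w,
      h.apply_word_F_mul i w, h.apply_word_mul_F i w⟩
  | zero => exact ⟨0, zero_mem _, 0, zero_mem _, by simp, by simp, by simp⟩
  | add x x' _ _ hx hx' =>
    obtain ⟨p, hp, q, hq, h1, h2, h3⟩ := hx
    obtain ⟨p', hp', q', hq', h1', h2', h3'⟩ := hx'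
    refine ⟨p + p', add_mem hp hp', q + q', add_mem hq hq', ?_, fun y => ?_, fun y => ?_⟩
    · simp only [AddMemClass.coe_add, mul_add, add_mul, add_sub_add_comm, h1, h1', smul_add]
    · rw [map_add, LinearMap.add_apply, h2, h2', map_add, LinearMap.add_apply, mul_add]
    · rw [map_add, LinearMap.add_apply, h3, h3', mul_add (KgeqGen D i), map_add,
        LinearMap.add_apply, mul_add]
  | smul a x _ hx =>
    obtain ⟨p, hp, q, hq, h1, h2, h3⟩ := hx
    refine ⟨a • p, Submodule.smul_mem _ a hp, a • q, Submodule.smul_mem _ a hq, ?_,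
      fun y => ?_, fun y => ?_⟩
    · simp only [SetLike.val_smul, mul_smul_comm, smul_mul_assoc, ← smul_sub, h1]
      rw [smul_comm]
    · rw [map_smul, LinearMap.smul_apply, h2, map_smul, LinearMap.smul_apply, smul_eq_mul,
        smul_eq_mul]; ring
    · rw [map_smul, LinearMap.smul_apply, h3, mul_smul_comm, map_smul, LinearMap.smul_apply,
        smul_eq_mul, smul_eq_mul]; ring

end IsSkewHopfPairing

end Commutators

/-! ### The canonical elements `Θ_ν` and their commutation with the generators. -/

section Theta

variable {I : Type*} [Fintype I] [DecidableEq I] {D : Datum I}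

theorem toZ_injective : Function.Injective (toZ : (I → ℕ) → I → ℤ) := fun a b h => by
  funext i
  exact Nat.cast_injective (R := ℤ) (congrFun h i)

theorem toZ_zero : toZ (0 : I → ℕ) = 0 := funext fun _ => rfl

theorem one_ne_zero_U : (1 : U D) ≠ 0 := fun h => by
  simpa using congrArg (counit D) h

namespace DualBases

variable (B : DualBases D)

instance (n : I → ℕ) : Fintype (B.ix n) := B.fin n

theorem nonempty_ix_zero : Nonempty (B.ix 0) := by
  by_contra hn
  rw [not_nonempty_iff] at hn
  have h1 : (1 : U D) ∈ Uplus D 0 := Submodule.subset_span ⟨[], rfl, rfl⟩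
  have : Subsingleton (Uplus D 0) := (B.bs 0).repr.toEquiv.subsingleton
  exact one_ne_zero_U (congrArg Subtype.val (Subsingleton.elim (⟨1, h1⟩ : Uplus D 0) 0))

/-- Dual bases can only exist if the skew-Hopf pairing does. -/
theorem isSkewHopfPairing (B : DualBases D) : IsSkewHopfPairing D (pairing D) := by
  by_cases h : ∃ φ, IsSkewHopfPairing D φ
  · rw [pairing, dif_pos h]
    exact h.choose_spec
  -- Without a skew-Hopf pairing, `pairing` takes its default value zero, contradicting `(b^*, b)_φ
  -- = 1` for a basis vector of degree zero.
  · obtain ⟨k⟩ := B.nonempty_ix_zero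
    have := B.dual 0 k k
    rw [pairing, dif_neg h] at this
    simp at this

/-- The basis vectors of `U⁻`, as elements of `U_{≤0}`. -/
def bleq (n : I → ℕ) (k : B.ix n) : Uleq D := ⟨B.b n k, Uminus_le D n (B.b n k).2⟩

/-- The dual basis vectors, as elements of `U_{≥0}`. -/
def bsgeq (n : I → ℕ) (k : B.ix n) : Ugeq D := ⟨B.bs n k, Uplus_le D n (B.bs n k).2⟩

theorem bleq_mem (n : I → ℕ) (k : B.ix n) : B.bleq n k ∈ wordSpan (Fleq D) (toZ n) := by
  rw [← coe_mem_wordSpan_F, ← Uminus_eq_wordSpan]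
  exact (B.b n k).2

theorem bsgeq_mem (n : I → ℕ) (k : B.ix n) : B.bsgeq n k ∈ wordSpan (Egeq D) (toZ n) := by
  rw [← coe_mem_wordSpan_E, ← Uplus_eq_wordSpan]
  exact (B.bs n k).2

open Classical in
theorem pairing_bsgeq_bleq (n : I → ℕ) (k l : B.ix n) :
    pairing D (B.bsgeq n k) (B.bleq n l) = if k = l then 1 else 0 := B.dual n k l

theorem theta_eq (n : I → ℕ) :
    B.theta n = ∑ k, (B.bleq n k : U D) ⊗ₜ[Qvt] (B.bsgeq n k : U D) := rfl

theorem sum_pairing_bleq {n : I → ℕ} {x : Ugeq D} (hx : x ∈ wordSpan (Egeq D) (toZ n)) :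
    ∑ k, pairing D x (B.bleq n k) • B.bsgeq n k = x := by
  classical
  rw [← coe_mem_wordSpan_E, ← Uplus_eq_wordSpan] at hx
  have e : x = ∑ k, (B.bs n).repr ⟨x, hx⟩ k • B.bsgeq n k := by
    apply Subtype.ext
    have := congrArg Subtype.val ((B.bs n).sum_repr ⟨x, hx⟩)
    simp only [Submodule.coe_sum, SetLike.val_smul] at this
    simpa [bsgeq] using this.symm
  generalize (B.bs n).repr ⟨x, hx⟩ = a at e
  subst e
  refine Finset.sum_congr rfl fun k _ => ?_
  simp [pairing_bsgeq_bleq]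

theorem sum_pairing_bsgeq {n : I → ℕ} {y : Uleq D} (hy : y ∈ wordSpan (Fleq D) (toZ n)) :
    ∑ k, pairing D (B.bsgeq n k) y • B.bleq n k = y := by
  classical
  rw [← coe_mem_wordSpan_F, ← Uminus_eq_wordSpan] at hy
  have e : y = ∑ k, (B.b n).repr ⟨y, hy⟩ k • B.bleq n k := by
    apply Subtype.ext
    have := congrArg Subtype.val ((B.b n).sum_repr ⟨y, hy⟩)
    simp only [Submodule.coe_sum, SetLike.val_smul] at this
    simpa [bleq] using this.symm
  generalize (B.b n).repr ⟨y, hy⟩ = a at e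
  subst e
  refine Finset.sum_congr rfl fun k _ => ?_
  simp [pairing_bsgeq_bleq]

/-- Adjoint maps can be moved from one tensor factor of the canonical element to the other. -/
theorem sum_tmul_adjoint {n m : I → ℕ} (q : B.ix n → Uleq D) (e : B.ix m → Ugeq D)
    (hq : ∀ k, q k ∈ wordSpan (Fleq D) (toZ m)) (he : ∀ l, e l ∈ wordSpan (Egeq D) (toZ n))
    (h : ∀ k l, pairing D (e l) (B.bleq n k) = pairing D (B.bsgeq m l) (q k)) :
    ∑ k, (q k : U D) ⊗ₜ[Qvt] (B.bsgeq n k : U D) = ∑ l, (B.bleq m l : U D) ⊗ₜ[Qvt] (e l : U D) := by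
  have h1 : ∀ k, (q k : U D) = ∑ l, pairing D (B.bsgeq m l) (q k) • (B.bleq m l : U D) := fun k => by
    conv_lhs => rw [← B.sum_pairing_bsgeq (hq k)]
    simp
  have h2 : ∀ l, (e l : U D) = ∑ k, pairing D (e l) (B.bleq n k) • (B.bsgeq n k : U D) := fun l => by
    conv_lhs => rw [← B.sum_pairing_bleq (he l)]
    simp
  have e1 : ∀ k, (q k : U D) ⊗ₜ[Qvt] (B.bsgeq n k : U D) = ∑ l,
      pairing D (B.bsgeq m l) (q k) • ((B.bleq m l : U D) ⊗ₜ[Qvt] (B.bsgeq n k : U D)) := fun k => by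
    conv_lhs => rw [h1 k, TensorProduct.sum_tmul]
    rfl
  have e2 : ∀ l, (B.bleq m l : U D) ⊗ₜ[Qvt] (e l : U D) = ∑ k,
      pairing D (e l) (B.bleq n k) • ((B.bleq m l : U D) ⊗ₜ[Qvt] (B.bsgeq n k : U D)) := fun l => by
    conv_lhs => rw [h2 l, TensorProduct.tmul_sum]
    simp only [TensorProduct.tmul_smul]
  -- Both sides are now expansions in the `b_l ⊗ b_k^*` with the same matrix of coefficients; only
  -- the order of summation differs.
  simp only [e1, e2, h]
  exact Finset.sum_comm

open Classical in
/-- `Θ_d` for `d ∈ ℤ[I]`, with `Θ_d = 0` for `d ∉ ℕ[I]`. -/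
def thetaZ (d : I → ℤ) : U D ⊗[Qvt] U D :=
  if h : ∃ n, toZ n = d then B.theta h.choose else 0

theorem thetaZ_toZ (n : I → ℕ) : B.thetaZ (toZ n) = B.theta n := by
  have h : ∃ m : I → ℕ, toZ m = toZ n := ⟨n, rfl⟩
  rw [thetaZ, dif_pos h, toZ_injective h.choose_spec]

theorem thetaZ_eq_zero {d : I → ℤ} (h : ∀ n : I → ℕ, toZ n ≠ d) : B.thetaZ d = 0 :=
  dif_neg (not_exists.2 h)

theorem toZ_ne_sub_sg {d : I → ℤ} (h : ∀ n : I → ℕ, toZ n ≠ d) (i : I) (n : I → ℕ) :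
    toZ n ≠ d - sg i := fun e => by
  refine h (n + Pi.single i 1) ?_
  rw [eq_sub_iff_add_eq] at e
  rw [← e]
  funext k
  by_cases hk : i = k
  · subst hk; simp [toZ, sg]
  · simp [toZ, sg, Ne.symm hk]

/-- By `exists_E_comm`, `[E_i ⊗ 1, Θ_ν]` is `c_i` times the sum of the `(K'_i p_k - K_i q_k) ⊗
b_k^*`. Transferring the two adjoints to the second leg turns its parts into `Θ_{ν-i} (K'_i ⊗ E_i)`
and `(K_i ⊗ E_i) Θ_{ν-i}`. -/
theorem thetaZ_mul_E (i : I) (d : I → ℤ) :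
    B.thetaZ d * (U.E D i ⊗ₜ 1) + B.thetaZ (d - sg i) * (U.K' D i ⊗ₜ U.E D i)
      = (U.E D i ⊗ₜ 1) * B.thetaZ d + (U.K D i ⊗ₜ U.E D i) * B.thetaZ (d - sg i) := by
  have h := B.isSkewHopfPairing
  by_cases hd : ∃ n, toZ n = d
  · obtain ⟨n, rfl⟩ := hd
    choose p hp q hq h1 h2 h3 using fun k => h.exists_E_comm i (B.bleq_mem n k)
    have key : (U.E D i ⊗ₜ 1) * B.theta n - B.theta n * (U.E D i ⊗ₜ 1)
        = D.pairEF i • ((U.K' D i ⊗ₜ 1) * ∑ k, (p k : U D) ⊗ₜ[Qvt] (B.bsgeq n k : U D)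
          - (U.K D i ⊗ₜ 1) * ∑ k, (q k : U D) ⊗ₜ[Qvt] (B.bsgeq n k : U D)) := by
      simp only [theta_eq, Finset.mul_sum, Finset.sum_mul, ← Finset.sum_sub_distrib,
        Algebra.TensorProduct.tmul_mul_tmul, one_mul, mul_one, ← TensorProduct.sub_tmul, h1,
        Finset.smul_sum, TensorProduct.smul_tmul']
    by_cases hm : ∃ m, toZ m = toZ n - sg i
    · obtain ⟨m, hm⟩ := hm
      simp only [← hm] at hp hq ⊢
      have hn : toZ n = sg i + toZ m := by rw [hm]; abel
      have eq : (U.K D i ⊗ₜ[Qvt] U.E D i) * B.theta m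
          = D.pairEF i • ((U.K D i ⊗ₜ 1) * ∑ k, (q k : U D) ⊗ₜ[Qvt] (B.bsgeq n k : U D)) := by
        have := B.sum_tmul_adjoint (fun k => D.pairEF i • q k) (fun l => Egeq D i * B.bsgeq m l)
          (fun k => Submodule.smul_mem _ _ (hq k))
          (fun l => by rw [hn]; exact mul_mem_wordSpan _ i (B.bsgeq_mem m l))
          (fun k l => by rw [h2, map_smul, smul_eq_mul])
        simp only [SetLike.val_smul, ← TensorProduct.smul_tmul', ← Finset.smul_sum,
          MulMemClass.coe_mul] at this
        rw [← mul_smul_comm, this, theta_eq]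
        simp only [Finset.mul_sum, Algebra.TensorProduct.tmul_mul_tmul, one_mul]
        rfl
      have ep : B.theta m * (U.K' D i ⊗ₜ[Qvt] U.E D i)
          = D.pairEF i • ((U.K' D i ⊗ₜ 1) * ∑ k, (p k : U D) ⊗ₜ[Qvt] (B.bsgeq n k : U D)) := by
        have := B.sum_tmul_adjoint (fun k => D.pairEF i • p k)
          -- The adjoint of right multiplication by `E_i` is `K'_i p`, not `p`; pairing with degree
          -- `m`, the factor `K'_i` contributes `{m, i}`, which is divided out here. It is recovered
          -- when `K'_i` is moved past `b_l`.
          (fun l => (D.brace (toZ m) (sg i))⁻¹ • (B.bsgeq m l * Egeq D i))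
          (fun k => Submodule.smul_mem _ _ (hp k))
          (fun l => by
            rw [hn]; exact Submodule.smul_mem _ _ (mul_mem_wordSpan_right _ i (B.bsgeq_mem m l)))
          (fun k l => by
            have := h.K_K'_wordSpan 0 (sg i) (B.bsgeq_mem m l) (hp k)
            rw [Kgeq_zero, one_mul, K'leq_sg, D.brace_zero_left, D.brace_zero_left, one_mul,
              one_mul] at this
            rw [map_smul, LinearMap.smul_apply, h3, this, map_smul, smul_eq_mul, smul_eq_mul,
              mul_left_comm, inv_mul_cancel_left₀ (D.brace_ne_zero _ _)])
        simp only [SetLike.val_smul, ← TensorProduct.smul_tmul', ← Finset.smul_sum,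
          MulMemClass.coe_mul] at this
        rw [← mul_smul_comm, this, theta_eq, Finset.mul_sum, Finset.sum_mul]
        refine Finset.sum_congr rfl fun l _ => ?_
        have hc := comm_wordSpan (ψ := fun a => D.brace a (sg i)) (D.brace_zero_left _)
          (fun a b => D.brace_add_left a b _) (U.K'_F_brace D i)
          ((coe_mem_wordSpan_F D).2 (B.bleq_mem m l))
        rw [Algebra.TensorProduct.tmul_mul_tmul, Algebra.TensorProduct.tmul_mul_tmul, hc, one_mul,
          TensorProduct.smul_tmul, smul_smul, mul_inv_cancel₀ (D.brace_ne_zero _ _), one_smul]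
        rfl
      rw [thetaZ_toZ, thetaZ_toZ, eq, ep, add_comm, ← sub_eq_sub_iff_add_eq_add, ← smul_sub, key]
    -- When `ν - i` lies outside `ℕ[I]`, all `p_k` and `q_k` vanish, so `E_i ⊗ 1` commutes with
    -- `Θ_ν`.
    · rw [wordSpan_eq_bot _ (not_exists.1 hm)] at hp hq
      simp only [Submodule.mem_bot] at hp hq
      rw [B.thetaZ_eq_zero (not_exists.1 hm), thetaZ_toZ, mul_zero, zero_mul, add_zero, add_zero,
        eq_comm, ← sub_eq_zero, key]
      simp [hp, hq]
  · rw [B.thetaZ_eq_zero (not_exists.1 hd), B.thetaZ_eq_zero (toZ_ne_sub_sg (not_exists.1 hd) i)]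
    simp

/-- The same argument on the second leg, with `exists_comm_F` applied to the `b_k^*`. The adjoint of
right multiplication by `F_i` is `K_i r`, so the correcting scalar is now `{i, m}`. -/
theorem thetaZ_mul_F (i : I) (d : I → ℤ) :
    B.thetaZ d * (1 ⊗ₜ U.F D i) + B.thetaZ (d - sg i) * (U.F D i ⊗ₜ U.K D i)
      = (1 ⊗ₜ U.F D i) * B.thetaZ d + (U.F D i ⊗ₜ U.K' D i) * B.thetaZ (d - sg i) := by
  have h := B.isSkewHopfPairing
  by_cases hd : ∃ n, toZ n = d
  · obtain ⟨n, rfl⟩ := hd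
    choose s hs r hr h1 h2 h3 using fun k => h.exists_comm_F i (B.bsgeq_mem n k)
    have key : B.theta n * (1 ⊗ₜ U.F D i) - (1 ⊗ₜ U.F D i) * B.theta n
        = D.pairEF i • ((1 ⊗ₜ U.K' D i) * ∑ k, (B.bleq n k : U D) ⊗ₜ[Qvt] (s k : U D)
          - (1 ⊗ₜ U.K D i) * ∑ k, (B.bleq n k : U D) ⊗ₜ[Qvt] (r k : U D)) := by
      simp only [theta_eq, Finset.mul_sum, Finset.sum_mul, ← Finset.sum_sub_distrib,
        Algebra.TensorProduct.tmul_mul_tmul, one_mul, mul_one, ← TensorProduct.tmul_sub, h1,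
        Finset.smul_sum, TensorProduct.tmul_smul]
    by_cases hm : ∃ m, toZ m = toZ n - sg i
    · obtain ⟨m, hm⟩ := hm
      simp only [← hm] at hs hr ⊢
      have hn : toZ n = sg i + toZ m := by rw [hm]; abel
      have es : (U.F D i ⊗ₜ[Qvt] U.K' D i) * B.theta m
          = D.pairEF i • ((1 ⊗ₜ U.K' D i) * ∑ k, (B.bleq n k : U D) ⊗ₜ[Qvt] (s k : U D)) := by
        have := B.sum_tmul_adjoint (fun l => Fleq D i * B.bleq m l) (fun k => D.pairEF i • s k)
          (fun l => by rw [hn]; exact mul_mem_wordSpan _ i (B.bleq_mem m l))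
          (fun k => Submodule.smul_mem _ _ (hs k))
          (fun l k => by rw [h2, map_smul, LinearMap.smul_apply, smul_eq_mul])
        simp only [SetLike.val_smul, TensorProduct.tmul_smul, ← Finset.smul_sum,
          MulMemClass.coe_mul] at this
        rw [← mul_smul_comm, ← this, theta_eq]
        simp only [Finset.mul_sum, Algebra.TensorProduct.tmul_mul_tmul, one_mul]
        rfl
      have er : B.theta m * (U.F D i ⊗ₜ[Qvt] U.K D i)
          = D.pairEF i • ((1 ⊗ₜ U.K D i) * ∑ k, (B.bleq n k : U D) ⊗ₜ[Qvt] (r k : U D)) := by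
        have := B.sum_tmul_adjoint
          (fun l => (D.brace (sg i) (toZ m))⁻¹ • (B.bleq m l * Fleq D i))
          (fun k => D.pairEF i • r k)
          (fun l => by
            rw [hn]; exact Submodule.smul_mem _ _ (mul_mem_wordSpan_right _ i (B.bleq_mem m l)))
          (fun k => Submodule.smul_mem _ _ (hr k))
          (fun l k => by
            have := h.K_K'_wordSpan (sg i) 0 (hr k) (B.bleq_mem m l)
            rw [K'leq_zero, one_mul, Kgeq_sg, D.brace_zero_right, D.brace_zero_right, one_mul,
              mul_one] at this
            rw [map_smul, map_smul, LinearMap.smul_apply, h3, this, smul_eq_mul, smul_eq_mul,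
              mul_left_comm _ (D.pairEF i), inv_mul_cancel_left₀ (D.brace_ne_zero _ _)])
        simp only [SetLike.val_smul, TensorProduct.tmul_smul, ← Finset.smul_sum,
          MulMemClass.coe_mul] at this
        rw [← mul_smul_comm, ← this, theta_eq, Finset.mul_sum, Finset.sum_mul]
        refine Finset.sum_congr rfl fun l _ => ?_
        have hc := comm_wordSpan (ψ := fun a => D.brace (sg i) a) (D.brace_zero_right _)
          (fun a b => D.brace_add_right _ a b) (U.K_E_brace D i)
          ((coe_mem_wordSpan_E D).2 (B.bsgeq_mem m l))
        rw [Algebra.TensorProduct.tmul_mul_tmul, Algebra.TensorProduct.tmul_mul_tmul, hc, one_mul,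
          ← TensorProduct.smul_tmul, smul_smul, mul_inv_cancel₀ (D.brace_ne_zero _ _), one_smul]
        rfl
      rw [thetaZ_toZ, thetaZ_toZ, es, er, add_comm (_ * B.theta n), ← sub_eq_sub_iff_add_eq_add, key,
        smul_sub]
    · rw [wordSpan_eq_bot _ (not_exists.1 hm)] at hs hr
      simp only [Submodule.mem_bot] at hs hr
      rw [B.thetaZ_eq_zero (not_exists.1 hm), thetaZ_toZ, mul_zero, zero_mul, add_zero, add_zero,
        ← sub_eq_zero, key]
      simp [hs, hr]
  · rw [B.thetaZ_eq_zero (not_exists.1 hd), B.thetaZ_eq_zero (toZ_ne_sub_sg (not_exists.1 hd) i)]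
    simp

/-- The legs `b` and `b^*` have opposite degrees, so the two scalars cancel. -/
theorem theta_mul_K (i : I) (n : I → ℕ) :
    B.theta n * (U.K D i ⊗ₜ U.K D i) = (U.K D i ⊗ₜ U.K D i) * B.theta n := by
  rw [theta_eq, Finset.mul_sum, Finset.sum_mul]
  refine Finset.sum_congr rfl fun k _ => ?_
  have h1 := comm_wordSpan (ψ := fun a => (D.brace (sg i) a)⁻¹) (by simp [D.brace_zero_right])
    (fun a b => by rw [D.brace_add_right, mul_inv]) (U.K_F_brace D i)
    ((coe_mem_wordSpan_F D).2 (B.bleq_mem n k))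
  have h2 := comm_wordSpan (ψ := fun a => D.brace (sg i) a) (D.brace_zero_right _)
    (fun a b => D.brace_add_right _ a b) (U.K_E_brace D i)
    ((coe_mem_wordSpan_E D).2 (B.bsgeq_mem n k))
  rw [Algebra.TensorProduct.tmul_mul_tmul, Algebra.TensorProduct.tmul_mul_tmul, h1, h2,
    TensorProduct.smul_tmul_smul, inv_mul_cancel₀ (D.brace_ne_zero _ _), one_smul]

theorem theta_mul_K' (i : I) (n : I → ℕ) :
    B.theta n * (U.K' D i ⊗ₜ U.K' D i) = (U.K' D i ⊗ₜ U.K' D i) * B.theta n := by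
  rw [theta_eq, Finset.mul_sum, Finset.sum_mul]
  refine Finset.sum_congr rfl fun k _ => ?_
  have h1 := comm_wordSpan (ψ := fun a => D.brace a (sg i)) (D.brace_zero_left _)
    (fun a b => D.brace_add_left a b _) (U.K'_F_brace D i)
    ((coe_mem_wordSpan_F D).2 (B.bleq_mem n k))
  have h2 := comm_wordSpan (ψ := fun a => (D.brace a (sg i))⁻¹) (by simp [D.brace_zero_left])
    (fun a b => by rw [D.brace_add_left, mul_inv]) (U.K'_E_brace D i)
    ((coe_mem_wordSpan_E D).2 (B.bsgeq_mem n k))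
  rw [Algebra.TensorProduct.tmul_mul_tmul, Algebra.TensorProduct.tmul_mul_tmul, h1, h2,
    TensorProduct.smul_tmul_smul, mul_inv_cancel₀ (D.brace_ne_zero _ _), one_smul]

/-- Degree zero of `U^+` consists of scalars, so `b_k^* = a_k 1` and `Θ_0` is the sum of the `a_k
b_k`, tensored with `1`. Since `a_k = (b_k^*, 1)_φ`, that sum is the expansion of `1` in the basis;
the number of basis vectors plays no role. -/
theorem theta_zero : B.theta 0 = 1 := by
  have hs : ∀ {x : Ugeq D}, x ∈ wordSpan (Egeq D) (toZ 0) → ∃ a : Qvt, x = a • 1 := by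
    intro x hx
    induction hx using Submodule.span_induction with
    | mem x hx =>
      obtain ⟨w, hw, rfl⟩ := hx
      cases w with
      | nil => exact ⟨1, by simp⟩
      | cons j w =>
        have := congrFun (toZ_injective hw) j
        simp [wordDeg] at this
    | zero => exact ⟨0, by simp⟩
    | add x y _ _ hx hy =>
      obtain ⟨a, rfl⟩ := hx
      obtain ⟨b, rfl⟩ := hy
      exact ⟨a + b, by rw [add_smul]⟩
    | smul c x _ hx =>
      obtain ⟨a, rfl⟩ := hx
      exact ⟨c * a, by rw [mul_smul]⟩
  have h1 : (1 : Uleq D) ∈ wordSpan (Fleq D) (toZ 0) := by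
    simpa [toZ_wordDeg_nil, toZ_zero] using word_mem_wordSpan (Fleq D) []
  have e := congrArg Subtype.val (B.sum_pairing_bsgeq h1)
  choose a ha using fun k => hs (B.bsgeq_mem 0 k)
  have h11 := B.isSkewHopfPairing.apply_one_one
  simp only [ha, map_smul, LinearMap.smul_apply, h11, smul_eq_mul, mul_one] at e
  rw [theta_eq, Algebra.TensorProduct.one_def]
  simp only [ha]
  change _ = (1 : U D) at e
  refine Eq.trans ?_ (congrArg (fun x : U D => x ⊗ₜ[Qvt] (1 : U D)) e)
  simp only [AddSubmonoidClass.coe_finsetSum, TensorProduct.sum_tmul]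
  refine Finset.sum_congr rfl fun k _ => ?_
  rw [SetLike.val_smul, SetLike.val_smul, TensorProduct.tmul_smul, TensorProduct.smul_tmul']
  rfl

end DualBases

end Theta

/-! ### Weight modules, finiteness and invertibility of `Θ` and `f̃`. -/

section WeightModules

variable {I : Type*} [Fintype I] [DecidableEq I] {D : Datum I}
  {M N : Type*} [AddCommGroup M] [Module Qvt M] [Module (U D) M] [IsScalarTower Qvt (U D) M]
  [AddCommGroup N] [Module Qvt N] [Module (U D) N] [IsScalarTower Qvt (U D) N]

theorem tensorEnd_tmul (a b : U D) (x : M) (y : N) :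
    tensorEnd D M N (a ⊗ₜ b) (x ⊗ₜ y) = (a • x) ⊗ₜ (b • y) := rfl

/-- Puts the eigenvalues in terms of the bicharacter governing the generators, so that weight shifts
and the effect on `f` become bilinearity. -/
theorem mem_weightSpace {l : I → ℤ} {x : M} : x ∈ weightSpace D M l ↔ ∀ i,
    U.K D i • x = D.brace (sg i) l • x ∧ U.K' D i • x = (D.brace l (sg i))⁻¹ • x := by
  simp only [Datum.brace_inv]
  simp only [show ∀ i, D.dot l (sg i) = D.dot (sg i) l from fun i => add_comm _ _]
  exact Iff.rfl

theorem smul_mem_weightSpace_of_wordSpan_E {l d : I → ℤ} {a : U D} {x : M}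
    (ha : a ∈ wordSpan (U.E D) d) (hx : x ∈ weightSpace D M l) :
    a • x ∈ weightSpace D M (l + d) := by
  rw [mem_weightSpace] at hx ⊢
  intro i
  have h1 := comm_wordSpan (ψ := fun a => D.brace (sg i) a) (D.brace_zero_right _)
    (fun a b => D.brace_add_right _ a b) (U.K_E_brace D i) ha
  have h2 := comm_wordSpan (ψ := fun a => (D.brace a (sg i))⁻¹) (by simp [D.brace_zero_left])
    (fun a b => by rw [D.brace_add_left, mul_inv]) (U.K'_E_brace D i) ha
  rw [← mul_smul, ← mul_smul, h1, h2, smul_assoc, smul_assoc, mul_smul, mul_smul, (hx i).1,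
    (hx i).2, smul_comm a, smul_comm a, smul_smul, smul_smul, D.brace_add_right,
    D.brace_add_left, mul_inv, mul_comm (D.brace (sg i) l), mul_comm (D.brace l (sg i))⁻¹]
  exact ⟨rfl, rfl⟩

theorem smul_mem_weightSpace_of_wordSpan_F {l d : I → ℤ} {a : U D} {x : M}
    (ha : a ∈ wordSpan (U.F D) d) (hx : x ∈ weightSpace D M l) :
    a • x ∈ weightSpace D M (l - d) := by
  obtain ⟨m, rfl⟩ : ∃ m, l = m + d := ⟨l - d, by simp⟩
  rw [add_sub_cancel_right]
  rw [mem_weightSpace] at hx ⊢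
  intro i
  have h1 := comm_wordSpan (ψ := fun a => (D.brace (sg i) a)⁻¹) (by simp [D.brace_zero_right])
    (fun a b => by rw [D.brace_add_right, mul_inv]) (U.K_F_brace D i) ha
  have h2 := comm_wordSpan (ψ := fun a => D.brace a (sg i)) (D.brace_zero_left _)
    (fun a b => D.brace_add_left a b _) (U.K'_F_brace D i) ha
  have e1 := D.brace_ne_zero (sg i) d
  have e2 := D.brace_ne_zero d (sg i)
  rw [← mul_smul, ← mul_smul, h1, h2, smul_assoc, smul_assoc, mul_smul, mul_smul, (hx i).1,
    (hx i).2, smul_comm a, smul_comm a, smul_smul, smul_smul, D.brace_add_right,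
    D.brace_add_left]
  constructor
  · congr 1; field_simp
  · congr 1; field_simp

theorem E_smul_mem_weightSpace (i : I) {l : I → ℤ} {x : M} (hx : x ∈ weightSpace D M l) :
    U.E D i • x ∈ weightSpace D M (l + sg i) := by
  refine smul_mem_weightSpace_of_wordSpan_E ?_ hx
  simpa [toZ_wordDeg_cons, toZ_wordDeg_nil] using word_mem_wordSpan (U.E D) [i]

theorem F_smul_mem_weightSpace (i : I) {l : I → ℤ} {x : M} (hx : x ∈ weightSpace D M l) :
    U.F D i • x ∈ weightSpace D M (l - sg i) := by
  refine smul_mem_weightSpace_of_wordSpan_F ?_ hx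
  simpa [toZ_wordDeg_cons, toZ_wordDeg_nil] using word_mem_wordSpan (U.F D) [i]

/-- A weight module is spanned by its weight vectors. -/
theorem IsWeightModule.induction (hM : IsWeightModule D M) {p : M → Prop}
    (hw : ∀ l, ∀ x ∈ weightSpace D M l, p x) (h0 : p 0) (hadd : ∀ x y, p x → p y → p (x + y))
    (x : M) : p x :=
  Submodule.iSup_induction (weightSpace D M) (motive := p)
    (by rw [DirectSum.IsInternal.submodule_iSup_eq_top hM]; trivial) hw h0 hadd

theorem IsWeightModule.ext_tmul {P : Type*} [AddCommGroup P] [Module Qvt P]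
    (hM : IsWeightModule D M) (hN : IsWeightModule D N) {f g : M ⊗[Qvt] N →ₗ[Qvt] P}
    (h : ∀ l m, ∀ x ∈ weightSpace D M l, ∀ y ∈ weightSpace D N m, f (x ⊗ₜ y) = g (x ⊗ₜ y)) :
    f = g := by
  refine TensorProduct.ext' fun x y => ?_
  refine hM.induction (p := fun x => f (x ⊗ₜ y) = g (x ⊗ₜ y)) (fun l x hx => ?_) (by simp)
    (fun x x' hx hx' => by simp only [TensorProduct.add_tmul, map_add, hx, hx']) x
  exact hN.induction (p := fun y => f (x ⊗ₜ y) = g (x ⊗ₜ y)) (fun m y hy => h l m x hx y hy)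
    (by simp) (fun y y' hy hy' => by simp only [TensorProduct.tmul_add, map_add, hy, hy']) y

theorem IsWeightModule.decomp_of_mem (hM : IsWeightModule D M) {l : I → ℤ} {x : M}
    (hx : x ∈ weightSpace D M l) :
    hM.decomp x = DirectSum.lof Qvt (I → ℤ) (fun l => weightSpace D M l) l ⟨x, hx⟩ := by
  refine (LinearEquiv.symm_apply_eq _).2 ?_
  exact (DirectSum.coeLinearMap_lof (weightSpace D M) l ⟨x, hx⟩).symm

theorem ftilde_tmul (hM : IsWeightModule D M) (hN : IsWeightModule D N) {l m : I → ℤ} {x : M}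
    {y : N} (hx : x ∈ weightSpace D M l) (hy : y ∈ weightSpace D N m) :
    ftilde hM hN (x ⊗ₜ y) = fmap D l m • x ⊗ₜ[Qvt] y := by
  simp [ftilde, ftildeAux, hM.decomp_of_mem hx, hN.decomp_of_mem hy]

/-- An independent family of submodules of a noetherian module has only finitely many nonzero
members. -/
theorem IsWeightModule.finite_weights [FiniteDimensional Qvt M] (hM : IsWeightModule D M) :
    {l | weightSpace D M l ≠ ⊥}.Finite :=
  WellFoundedGT.finite_ne_bot_of_iSupIndep hM.submodule_iSupIndep

namespace DualBases

variable (B : DualBases D)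

-- The dual bases are needed because their existence is what guarantees that `pairing` is a genuine
-- skew-Hopf pairing.
include B in
theorem fmap_eq (l m : I → ℤ) : fmap D l m = (D.brace l m)⁻¹ := by
  rw [fmap, B.isSkewHopfPairing.apply_Kgeq_K'leq]

theorem tensorEnd_theta_tmul (n : I → ℕ) (x : M) (y : N) :
    tensorEnd D M N (B.theta n) (x ⊗ₜ y)
      = ∑ k, ((B.bleq n k : U D) • x) ⊗ₜ[Qvt] ((B.bsgeq n k : U D) • y) := by
  rw [theta_eq, map_sum, LinearMap.sum_apply]
  rfl

theorem bleq_smul_mem (n : I → ℕ) (k : B.ix n) {l : I → ℤ} {x : M}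
    (hx : x ∈ weightSpace D M l) : (B.bleq n k : U D) • x ∈ weightSpace D M (l - toZ n) :=
  smul_mem_weightSpace_of_wordSpan_F ((coe_mem_wordSpan_F D).2 (B.bleq_mem n k)) hx

/-- If `Θ_ν` acts nontrivially, some `λ` and `λ - ν` are both weights of the first factor, so `ν` is
a difference of two of its finitely many weights. -/
theorem finite_theta [FiniteDimensional Qvt M] (hM : IsWeightModule D M)
    (hN : IsWeightModule D N) : {n : I → ℕ | tensorEnd D M N (B.theta n) ≠ 0}.Finite := by
  have hf := (hM.finite_weights.image2 (fun a b => a - b) hM.finite_weights).preimage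
    (f := toZ) toZ_injective.injOn
  refine hf.subset fun n hn => ?_
  by_contra hc
  refine hn (hM.ext_tmul hN fun l m x hx y hy => ?_)
  rw [B.tensorEnd_theta_tmul, LinearMap.zero_apply]
  refine Finset.sum_eq_zero fun k _ => ?_
  by_cases h0 : (B.bleq n k : U D) • x = 0
  · rw [h0, TensorProduct.zero_tmul]
  · refine (hc ⟨l, fun h => ?_, l - toZ n, fun h => ?_, by simp⟩).elim
    · rw [h, Submodule.mem_bot] at hx
      exact h0 (by rw [hx, smul_zero])
    · have := B.bleq_smul_mem n k hx
      rw [h, Submodule.mem_bot] at this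
      exact h0 this

variable [FiniteDimensional Qvt M] (hM : IsWeightModule D M) (hN : IsWeightModule D N)

include hM hN in
theorem finite_thetaZ :
    (Function.support fun d => tensorEnd D M N (B.thetaZ d)).Finite := by
  refine ((B.finite_theta hM hN).image toZ).subset fun d hd => ?_
  by_cases h : ∃ n, toZ n = d
  · obtain ⟨n, rfl⟩ := h
    rw [Function.mem_support, thetaZ_toZ] at hd
    exact ⟨n, hd, rfl⟩
  · rw [Function.mem_support, B.thetaZ_eq_zero (not_exists.1 h), map_zero] at hd
    exact (hd rfl).elim

-- Extending the index set to `ℤ[I]` adds only zero terms and makes the shift `d ↦ d - i` a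
-- bijection of it.
variable (M N) in
theorem thetaOp_eq_finsum : B.thetaOp M N = ∑ᶠ d, tensorEnd D M N (B.thetaZ d) := by
  have h : Set.indicator (Set.range toZ) (fun d => tensorEnd D M N (B.thetaZ d))
      = fun d => tensorEnd D M N (B.thetaZ d) := by
    refine Set.indicator_eq_self.2 fun d hd => ?_
    by_contra hc
    exact hd (by
      change tensorEnd D M N (B.thetaZ d) = 0
      rw [B.thetaZ_eq_zero fun n hn => hc ⟨n, hn⟩, map_zero])
  rw [← h, ← finsum_mem_def, finsum_mem_range toZ_injective]
  simp only [thetaZ_toZ]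
  rfl

include hM hN in
/-- A relation between the `Θ_d` and the `Θ_{d-i}` yields a relation for `Θ`. -/
theorem thetaOp_relation (i : I) {a b a' b' : U D ⊗[Qvt] U D}
    (h : ∀ d, B.thetaZ d * a + B.thetaZ (d - sg i) * b
      = a' * B.thetaZ d + b' * B.thetaZ (d - sg i)) :
    B.thetaOp M N * tensorEnd D M N (a + b) = tensorEnd D M N (a' + b') * B.thetaOp M N := by
  have hf := B.finite_thetaZ hM hN
  have hf' : (Function.support fun d => tensorEnd D M N (B.thetaZ (d - sg i))).Finite :=
    hf.preimage (f := fun d => d - sg i) (sub_left_injective.injOn)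
  have hs : B.thetaOp M N = ∑ᶠ d, tensorEnd D M N (B.thetaZ (d - sg i)) := by
    rw [thetaOp_eq_finsum]
    exact (finsum_comp_equiv (Equiv.subRight (sg i))).symm
  have hl : ∀ {f : (I → ℤ) → Module.End Qvt (M ⊗[Qvt] N)} (c), (Function.support f).Finite →
      (Function.support fun d => c * f d).Finite := fun c h => h.subset fun d hd h0 =>
    hd (by change c * _ = 0; rw [h0, mul_zero])
  have hr : ∀ {f : (I → ℤ) → Module.End Qvt (M ⊗[Qvt] N)} (c), (Function.support f).Finite →
      (Function.support fun d => f d * c).Finite := fun c h => h.subset fun d hd h0 =>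
    hd (by change _ * c = 0; rw [h0, zero_mul])
  rw [map_add, map_add, mul_add, add_mul]
  -- Only the copies of `Θ` multiplying `b` and `b'` become shifted sums; the index in the next
  -- rewrite counts the copies left after this one.
  nth_rewrite 2 [hs]
  nth_rewrite 3 [hs]
  rw [thetaOp_eq_finsum, finsum_mul' _ _ hf, finsum_mul' _ _ hf', mul_finsum' _ _ hf,
    mul_finsum' _ _ hf', ← finsum_add_distrib (hr _ hf) (hr _ hf'),
    ← finsum_add_distrib (hl _ hf) (hl _ hf')]
  refine finsum_congr fun d => ?_
  rw [← map_mul, ← map_mul, ← map_mul, ← map_mul, ← map_add, ← map_add, h]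

include hM hN in
theorem thetaOp_commute {a : U D ⊗[Qvt] U D} (h : ∀ n, B.theta n * a = a * B.theta n) :
    B.thetaOp M N * tensorEnd D M N a = tensorEnd D M N a * B.thetaOp M N := by
  have hf := B.finite_theta hM hN
  rw [thetaOp, finsum_mul' _ _ hf, mul_finsum' _ _ hf]
  exact finsum_congr fun n => by rw [← map_mul, ← map_mul, h]

-- For `ν ≠ 0`, `Θ_ν` lowers the height (the sum of the coordinates) of the weight in the first
-- factor by at least one. The heights of the weights are bounded, so `Θ - 1` is nilpotent.
include hM hN in
theorem isUnit_thetaOp : IsUnit (B.thetaOp M N) := by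
  classical
  set S := (B.finite_theta hM hN).toFinset with hS
  have hsum : B.thetaOp M N = 1 + ∑ n ∈ S.erase 0, tensorEnd D M N (B.theta n) := by
    rw [thetaOp, finsum_eq_sum_of_support_subset (s := insert 0 S)]
    · rw [← Finset.insert_erase (Finset.mem_insert_self 0 S),
        Finset.sum_insert (Finset.notMem_erase _ _), theta_zero, map_one,
        Finset.erase_insert_eq_erase]
    · intro n hn
      simp only [Finset.coe_insert, Set.mem_insert_iff]
      exact Or.inr (by simpa [hS] using hn)
  rw [hsum]
  refine IsNilpotent.isUnit_one_add ?_
  set Nil := ∑ n ∈ S.erase 0, tensorEnd D M N (B.theta n)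
  let ht : (I → ℤ) → ℤ := fun l => ∑ i, l i
  obtain ⟨lo, hlo⟩ := (hM.finite_weights.image ht).bddBelow
  obtain ⟨hi, hhi⟩ := (hM.finite_weights.image ht).bddAbove
  -- `k` applications push a height below `lo + k` under `lo`, where there are no weights.
  have key : ∀ (k : ℕ) (l : I → ℤ) (x : M), x ∈ weightSpace D M l → ht l < lo + k → ∀ y : N,
      (Nil ^ k) (x ⊗ₜ[Qvt] y) = 0 := by
    intro k
    induction k with
    | zero =>
      intro l x hx hl y
      by_cases h : weightSpace D M l = ⊥
      · rw [h, Submodule.mem_bot] at hx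
        rw [hx, TensorProduct.zero_tmul, map_zero]
      · have := hlo ⟨l, h, rfl⟩
        simp only [Nat.cast_zero, add_zero] at hl
        exact absurd hl (not_lt.2 this)
    | succ k ih =>
      intro l x hx hl y
      rw [pow_succ, Module.End.mul_apply]
      simp only [Nil, LinearMap.sum_apply, map_sum, B.tensorEnd_theta_tmul]
      refine Finset.sum_eq_zero fun n hn => Finset.sum_eq_zero fun j _ => ?_
      refine ih _ _ (B.bleq_smul_mem n j hx) ?_ _
      have hn0 : n ≠ 0 := Finset.ne_of_mem_erase hn
      obtain ⟨i, hi⟩ := Function.ne_iff.1 hn0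
      have h1 : (1 : ℤ) ≤ ∑ i, (n i : ℤ) := by
        refine le_trans ?_ (Finset.single_le_sum (fun i _ => Int.natCast_nonneg (n i))
          (Finset.mem_univ i))
        exact_mod_cast Nat.one_le_iff_ne_zero.2 hi
      have h2 : ht (l - toZ n) = ht l - ∑ i, (n i : ℤ) := by
        simp only [ht, Pi.sub_apply, Finset.sum_sub_distrib, toZ]
      push_cast at hl
      omega
  -- `hi - lo + 1` bounds the number of heights; the truncation is active only if there are no
  -- weights at all, and then every weight vector is zero.
  refine ⟨(hi - lo + 1).toNat, hM.ext_tmul hN fun l m x hx y _ => ?_⟩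
  rw [LinearMap.zero_apply]
  by_cases h : weightSpace D M l = ⊥
  · rw [h, Submodule.mem_bot] at hx
    rw [hx, TensorProduct.zero_tmul, map_zero]
  · refine key _ l x hx ?_ y
    have : ht l ≤ hi := hhi ⟨l, h, rfl⟩
    omega

-- The values of `f` are invertible, so the range contains every tensor of weight vectors;
-- injectivity follows from finite dimension.
include B in
theorem bijective_ftilde [FiniteDimensional Qvt N] : Function.Bijective (ftilde hM hN) := by
  have hs : Function.Surjective (ftilde hM hN) := by
    rw [← LinearMap.range_eq_top, ← Submodule.ker_mkQ (LinearMap.range (ftilde hM hN)),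
      LinearMap.ker_eq_top]
    refine hM.ext_tmul hN fun l m x hx y hy => ?_
    rw [LinearMap.zero_apply, Submodule.mkQ_apply, Submodule.Quotient.mk_eq_zero]
    refine ⟨D.brace l m • x ⊗ₜ y, ?_⟩
    rw [map_smul, ftilde_tmul hM hN hx hy, B.fmap_eq, smul_smul,
      mul_inv_cancel₀ (D.brace_ne_zero _ _), one_smul]
  exact ⟨LinearMap.injective_iff_surjective.2 hs, hs⟩

end DualBases

end WeightModules

/-! ### Compatibility of `𝓡` with the action of `U`. -/

section Intertwining

variable {I : Type*} [Fintype I] [DecidableEq I] {D : Datum I}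
  {M N : Type*} [AddCommGroup M] [Module Qvt M] [Module (U D) M] [IsScalarTower Qvt (U D) M]
  [AddCommGroup N] [Module Qvt N] [Module (U D) N] [IsScalarTower Qvt (U D) N]

/-- This is where `Δ^op` enters: the flip carries the action through `Δ` to the action through
`Δ^op`. -/
theorem comm_tensorEnd (a : U D ⊗[Qvt] U D) (z : M ⊗[Qvt] N) :
    TensorProduct.comm Qvt M N (tensorEnd D M N a z)
      = tensorEnd D N M (TensorProduct.comm Qvt (U D) (U D) a) (TensorProduct.comm Qvt M N z) := by
  induction a using TensorProduct.induction_on with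
  | zero => simp
  | add a b ha hb => simp only [map_add, LinearMap.add_apply, ha, hb]
  | tmul a b =>
    induction z using TensorProduct.induction_on with
    | zero => simp
    | add z z' hz hz' => simp only [map_add, hz, hz']
    | tmul x y => rfl

theorem mem_of_gen_mem (S : Subalgebra Qvt (U D)) (h : ∀ x, U.gen D x ∈ S) (u : U D) : u ∈ S := by
  obtain ⟨a, rfl⟩ := RingQuot.mkAlgHom_surjective Qvt (Rel D) u
  suffices hs : (⊤ : Subalgebra Qvt (FreeAlgebra Qvt (Gen I))) ≤ S.comap (U.mk D) from
    hs (Algebra.mem_top (x := a))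
  rw [← FreeAlgebra.adjoin_range_ι]
  refine Algebra.adjoin_le ?_
  rintro _ ⟨x, rfl⟩
  exact h x

/-- The elements of an algebra with whose actions a linear map commutes. -/
def intertwined {A V W : Type*} [Ring A] [Algebra Qvt A] [AddCommGroup V] [Module Qvt V]
    [AddCommGroup W] [Module Qvt W] (ρ : A →ₐ[Qvt] Module.End Qvt V)
    (σ : A →ₐ[Qvt] Module.End Qvt W) (R : V →ₗ[Qvt] W) : Subalgebra Qvt A where
  carrier := {u | ∀ z, R (ρ u z) = σ u (R z)}
  mul_mem' ha hb z := by
    rw [map_mul, map_mul, Module.End.mul_apply, Module.End.mul_apply, ha, hb]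
  add_mem' ha hb z := by
    rw [map_add, map_add, LinearMap.add_apply, LinearMap.add_apply, map_add, ha, hb]
  algebraMap_mem' c z := by
    rw [AlgHom.commutes, AlgHom.commutes, Module.algebraMap_end_apply,
      Module.algebraMap_end_apply, map_smul]

theorem intertwined_inv_mem {A V W : Type*} [Ring A] [Algebra Qvt A] [AddCommGroup V]
    [Module Qvt V] [AddCommGroup W] [Module Qvt W] {ρ : A →ₐ[Qvt] Module.End Qvt V}
    {σ : A →ₐ[Qvt] Module.End Qvt W} {R : V →ₗ[Qvt] W} {a b : A} (h1 : a * b = 1)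
    (h2 : b * a = 1) (ha : a ∈ intertwined ρ σ R) : b ∈ intertwined ρ σ R := fun z => by
  have e1 : ρ a (ρ b z) = z := by rw [← Module.End.mul_apply, ← map_mul, h1, map_one]; rfl
  have e2 : ∀ w, σ b (σ a w) = w := fun w => by
    rw [← Module.End.mul_apply, ← map_mul, h2, map_one]; rfl
  rw [← e2 (R (ρ b z)), ← ha, e1]

namespace DualBases

variable (B : DualBases D) (hM : IsWeightModule D M) (hN : IsWeightModule D N)

include B

/-- Raising the second weight by `i` multiplies `f(λ, μ)` by `{λ, i}⁻¹`, the eigenvalue of `K'_i` on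
weight `λ`. -/
theorem ftilde_one_tmul_E (i : I) :
    ftilde hM hN ∘ₗ tensorEnd D M N (1 ⊗ₜ U.E D i)
      = tensorEnd D M N (U.K' D i ⊗ₜ U.E D i) ∘ₗ ftilde hM hN := by
  refine hM.ext_tmul hN fun l m x hx y hy => ?_
  rw [LinearMap.comp_apply, LinearMap.comp_apply, tensorEnd_tmul, one_smul, ftilde_tmul hM hN hx hy,
    ftilde_tmul hM hN hx (E_smul_mem_weightSpace i hy), map_smul, tensorEnd_tmul,
    (mem_weightSpace.1 hx i).2, ← TensorProduct.smul_tmul', smul_smul, B.fmap_eq, B.fmap_eq,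
    D.brace_add_right, mul_inv]

/-- Raising the first weight by `i` multiplies `f(λ, μ)` by `{i, μ}⁻¹`, which cancels the eigenvalue
of `K_i` on weight `μ`. -/
theorem ftilde_E_tmul_K (i : I) :
    ftilde hM hN ∘ₗ tensorEnd D M N (U.E D i ⊗ₜ U.K D i)
      = tensorEnd D M N (U.E D i ⊗ₜ 1) ∘ₗ ftilde hM hN := by
  refine hM.ext_tmul hN fun l m x hx y hy => ?_
  rw [LinearMap.comp_apply, LinearMap.comp_apply, tensorEnd_tmul, ftilde_tmul hM hN hx hy,
    (mem_weightSpace.1 hy i).1, TensorProduct.tmul_smul, map_smul,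
    ftilde_tmul hM hN (E_smul_mem_weightSpace i hx) hy, map_smul, tensorEnd_tmul, one_smul,
    smul_smul, B.fmap_eq, B.fmap_eq, D.brace_add_left, mul_inv, mul_left_comm,
    mul_inv_cancel₀ (D.brace_ne_zero _ _), mul_one]

theorem ftilde_F_tmul_one (i : I) :
    ftilde hM hN ∘ₗ tensorEnd D M N (U.F D i ⊗ₜ 1)
      = tensorEnd D M N (U.F D i ⊗ₜ U.K D i) ∘ₗ ftilde hM hN := by
  refine hM.ext_tmul hN fun l m x hx y hy => ?_
  have e : D.brace l m = D.brace (l - sg i) m * D.brace (sg i) m := by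
    rw [← D.brace_add_left, sub_add_cancel]
  rw [LinearMap.comp_apply, LinearMap.comp_apply, tensorEnd_tmul, ftilde_tmul hM hN hx hy,
    one_smul, ftilde_tmul hM hN (F_smul_mem_weightSpace i hx) hy, map_smul, tensorEnd_tmul,
    (mem_weightSpace.1 hy i).1, TensorProduct.tmul_smul, smul_smul, B.fmap_eq, B.fmap_eq, e,
    mul_inv, mul_assoc, inv_mul_cancel₀ (D.brace_ne_zero _ _), mul_one]

theorem ftilde_K'_tmul_F (i : I) :
    ftilde hM hN ∘ₗ tensorEnd D M N (U.K' D i ⊗ₜ U.F D i)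
      = tensorEnd D M N (1 ⊗ₜ U.F D i) ∘ₗ ftilde hM hN := by
  refine hM.ext_tmul hN fun l m x hx y hy => ?_
  have e : D.brace l m = D.brace l (m - sg i) * D.brace l (sg i) := by
    rw [← D.brace_add_right, sub_add_cancel]
  rw [LinearMap.comp_apply, LinearMap.comp_apply, tensorEnd_tmul, ftilde_tmul hM hN hx hy,
    (mem_weightSpace.1 hx i).2, ← TensorProduct.smul_tmul', map_smul,
    ftilde_tmul hM hN hx (F_smul_mem_weightSpace i hy), map_smul, tensorEnd_tmul, one_smul,
    smul_smul, B.fmap_eq, B.fmap_eq, e, mul_inv, mul_comm]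

omit B in
theorem ftilde_K_tmul_K (i : I) :
    ftilde hM hN ∘ₗ tensorEnd D M N (U.K D i ⊗ₜ U.K D i)
      = tensorEnd D M N (U.K D i ⊗ₜ U.K D i) ∘ₗ ftilde hM hN := by
  refine hM.ext_tmul hN fun l m x hx y hy => ?_
  rw [LinearMap.comp_apply, LinearMap.comp_apply, ftilde_tmul hM hN hx hy, map_smul,
    tensorEnd_tmul, (mem_weightSpace.1 hx i).1, (mem_weightSpace.1 hy i).1,
    TensorProduct.smul_tmul_smul, map_smul, ftilde_tmul hM hN hx hy, smul_comm]

omit B in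
theorem ftilde_K'_tmul_K' (i : I) :
    ftilde hM hN ∘ₗ tensorEnd D M N (U.K' D i ⊗ₜ U.K' D i)
      = tensorEnd D M N (U.K' D i ⊗ₜ U.K' D i) ∘ₗ ftilde hM hN := by
  refine hM.ext_tmul hN fun l m x hx y hy => ?_
  rw [LinearMap.comp_apply, LinearMap.comp_apply, ftilde_tmul hM hN hx hy, map_smul,
    tensorEnd_tmul, (mem_weightSpace.1 hx i).2, (mem_weightSpace.1 hy i).2,
    TensorProduct.smul_tmul_smul, map_smul, ftilde_tmul hM hN hx hy, smul_comm]

/-- Splits the intertwining property at an intermediate element `c`: `f̃` carries `Δ^op(u)` to `c`,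
and `Θ` carries `c` to `Δ(u)`. -/
theorem Rmat_intertwines_of {u : U D} {c : U D ⊗[Qvt] U D}
    (hf : ftilde hN hM ∘ₗ tensorEnd D N M (TensorProduct.comm Qvt (U D) (U D) (comul D u))
      = tensorEnd D N M c ∘ₗ ftilde hN hM)
    (hθ : B.thetaOp N M * tensorEnd D N M c = tensorEnd D N M (comul D u) * B.thetaOp N M) :
    u ∈ intertwined (tensorAct D M N) (tensorAct D N M) (B.Rmat hM hN) := fun z => by
  change B.thetaOp N M (ftilde hN hM (TensorProduct.comm Qvt M N (tensorEnd D M N (comul D u) z)))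
    = tensorEnd D N M (comul D u) (B.thetaOp N M (ftilde hN hM (TensorProduct.comm Qvt M N z)))
  rw [comm_tensorEnd]
  have h1 := LinearMap.congr_fun hf (TensorProduct.comm Qvt M N z)
  rw [LinearMap.comp_apply, LinearMap.comp_apply] at h1
  rw [h1]
  exact LinearMap.congr_fun hθ (ftilde hN hM (TensorProduct.comm Qvt M N z))

theorem Rmat_intertwines [FiniteDimensional Qvt N] (u : U D) :
    u ∈ intertwined (tensorAct D M N) (tensorAct D N M) (B.Rmat hM hN) := by
  have hK : ∀ i, U.K D i ∈ intertwined (tensorAct D M N) (tensorAct D N M) (B.Rmat hM hN) :=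
    fun i => by
      have e : comul D (U.K D i) = U.K D i ⊗ₜ U.K D i := comul_gen D _
      refine B.Rmat_intertwines_of hM hN (c := U.K D i ⊗ₜ U.K D i) ?_ ?_
      · rw [e, TensorProduct.comm_tmul, ftilde_K_tmul_K]
      · rw [e]
        exact B.thetaOp_commute hN hM (B.theta_mul_K i)
  have hK' : ∀ i, U.K' D i ∈ intertwined (tensorAct D M N) (tensorAct D N M) (B.Rmat hM hN) :=
    fun i => by
      have e : comul D (U.K' D i) = U.K' D i ⊗ₜ U.K' D i := comul_gen D _
      refine B.Rmat_intertwines_of hM hN (c := U.K' D i ⊗ₜ U.K' D i) ?_ ?_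
      · rw [e, TensorProduct.comm_tmul, ftilde_K'_tmul_K']
      · rw [e]
        exact B.thetaOp_commute hN hM (B.theta_mul_K' i)
  refine mem_of_gen_mem _ (fun x => ?_) u
  cases x with
  | K i => exact hK i
  | K' i => exact hK' i
  | Kinv i => exact intertwined_inv_mem (U.K_Kinv D i) (U.Kinv_K D i) (hK i)
  | K'inv i => exact intertwined_inv_mem (U.K'_K'inv D i) (U.K'inv_K' D i) (hK' i)
  | E i =>
    have e : comul D (U.gen D (.E i)) = U.E D i ⊗ₜ 1 + U.K D i ⊗ₜ U.E D i := comul_gen D _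
    -- The intermediate element is `Δ(E_i)` with `K_i` replaced by `K'_i`; for `F_i` the replacement
    -- goes the other way.
    refine B.Rmat_intertwines_of hM hN (c := U.E D i ⊗ₜ 1 + U.K' D i ⊗ₜ U.E D i) ?_ ?_
    · rw [e, map_add, TensorProduct.comm_tmul, TensorProduct.comm_tmul, map_add, map_add,
        LinearMap.comp_add, LinearMap.add_comp, B.ftilde_one_tmul_E, B.ftilde_E_tmul_K, add_comm]
    · rw [e]
      exact B.thetaOp_relation hN hM i (B.thetaZ_mul_E i)
  | F i =>
    have e : comul D (U.gen D (.F i)) = 1 ⊗ₜ U.F D i + U.F D i ⊗ₜ U.K' D i := comul_gen D _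
    refine B.Rmat_intertwines_of hM hN (c := 1 ⊗ₜ U.F D i + U.F D i ⊗ₜ U.K D i) ?_ ?_
    · rw [e, map_add, TensorProduct.comm_tmul, TensorProduct.comm_tmul, map_add, map_add,
        LinearMap.comp_add, LinearMap.add_comp, B.ftilde_F_tmul_one, B.ftilde_K'_tmul_F, add_comm]
    · rw [e]
      exact B.thetaOp_relation hN hM i (B.thetaZ_mul_F i)

theorem bijective_Rmat [FiniteDimensional Qvt M] [FiniteDimensional Qvt N] :
    Function.Bijective (B.Rmat hM hN) :=
  ((Module.End.isUnit_iff _).1 (B.isUnit_thetaOp hN hM)).comp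
    ((B.bijective_ftilde hN hM).comp (TensorProduct.comm Qvt M N).bijective)

end DualBases

end Intertwining

end TwoParam

end

open TwoParam in
theorem mainTheorem3 {I : Type*} [Fintype I] [DecidableEq I] (D : Datum I) (B : DualBases D)
    (M M' : Type*)
    [AddCommGroup M] [Module Qvt M] [Module (U D) M] [IsScalarTower Qvt (U D) M]
    [AddCommGroup M'] [Module Qvt M'] [Module (U D) M'] [IsScalarTower Qvt (U D) M']
    [FiniteDimensional Qvt M] [FiniteDimensional Qvt M']
    (hM : IsWeightModule D M) (hM' : IsWeightModule D M') :
    {n : I → ℕ | tensorEnd D M' M (B.theta n) ≠ 0}.Finite ∧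
    Function.Bijective (B.Rmat hM hM') ∧
    ∀ (u : U D) (z : TensorProduct Qvt M M'),
      B.Rmat hM hM' (tensorAct D M M' u z) = tensorAct D M' M u (B.Rmat hM hM' z) :=
  ⟨B.finite_theta hM' hM, B.bijective_Rmat hM hM', fun u => B.Rmat_intertwines hM hM' u⟩
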